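/- Let $q$ be even. Represent a point $P=(y_0,\dots,y_5)$ of $\mathrm{PG}(5,q)$ by the symmetric matrix $$M_P=\begin{pmatrix}y_0&y_1&y_2\\ y_1&y_3&y_4\\ y_2&y_4&y_5\end{pmatrix},$$ and call the rank of $M_P$ the rank of $P$. Let $K\cong\mathrm{PGL}(3,q)$ be the group of projectivities $M_P\mapsto AM_PA^{T}$, $A\in\mathrm{GL}(3,q)$, of $\mathrm{PG}(5,q)$. Let $\mathcal P_1$ and $\mathcal P_3$ be the sets of points of rank $1$ and $3$, let $\mathcal P_{2,n}$ be the set of points of rank $2$ in the nucleus plane $y_0=y_3=y_5=0$, and let $\mathcal P_{2,s}$ be the set of the other points of rank $2$. A conic of $\mathrm{PG}(2,q)$ is a nonzero quadratic form $\sum_{0\le i\le j\le 2}a_{ij}X_iX_j$ over $\mathbb F_q$, up to scalars; it corresponds to the hyperplane $a_{00}Y_0+a_{01}Y_1+a_{02}Y_2+a_{11}Y_3+a_{12}Y_4+a_{22}Y_5=0$ of $\mathrm{PG}(5,q)$. Let $\mathcal H_1$, $\mathcal H_{2,r}$, $\mathcal H_{2,i}$, $\mathcal H_3$ be the sets of hyperplanes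 corresponding to double lines, pairs of distinct lines over $\mathbb F_q$, pairs of distinct lines over $\mathbb F_{q^2}$ that are conjugate under $x\mapsto x^q$, and non-singular conics (those with nonzero discriminant $4a_{00}a_{11}a_{22}+a_{01}a_{02}a_{12}-a_{00}a_{12}^2-a_{11}a_{02}^2-a_{22}a_{01}^2$). For a point $P$ let $OD_4(P)=[h_1,h_{2,r},h_{2,i},h_3]$ be the numbers of hyperplanes through $P$ in $\mathcal H_1,\mathcal H_{2,r},\mathcal H_{2,i},\mathcal H_3$. Then $\mathcal P_1,\mathcal P_{2,n},\mathcal P_{2,s},\mathcal P_3$ are the four $K$-orbits of points, and $\mathcal H_1,\mathcal H_{2,r},\mathcal H_{2,i},\mathcal H_3$ are the four $K$-orbits of hyperplanes, of $\mathrm{PG}(5,q)$, and $$OD_4(P)=\begin{cases} \left[q+1,\ q^3+\frac{3q^2+q}{2},\ \frac{q^2-q}{2},\ q^4-q^2\right] & \text{if } P\in\mathcal P_1,\\[4pt] \left[q^2+q+1,\ \frac{q^3+2q^2+q}{2},\ \frac{q^3-q}{2},\ q^4-q^2\right] & \text{if } P\in\mathcal P_{2,n},\\[4pt] \left[q+1,\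 \frac{q^3+3q^2+q}{2},\ \frac{q^3+q^2-q}{2},\ q^4-q^2\right] & \text{if } P\in\mathcal P_{2,s},\\[4pt] \left[q+1,\ \frac{q^3+2q^2+q}{2},\ \frac{q^3-q}{2},\ q^4\right] & \text{if } P\in\mathcal P_3. \end{cases}$$ Moreover, sending $P=(y_0,\dots,y_5)$ to the linear system $\mathcal S_P$ of all conics with $a_{00}y_0+a_{01}y_1+a_{02}y_2+a_{11}y_3+a_{12}y_4+a_{22}y_5=0$ is a bijection from the points of $\mathrm{PG}(5,q)$ to the squabs of conics of $\mathrm{PG}(2,q)$ (the linear systems of conics of codimension one), and $OD_4(P)$ lists the numbers of double lines, pairs of distinct lines over $\mathbb F_q$, pairs of conjugate imaginary lines, and non-singular conics in $\mathcal S_P$. -/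

import Mathlib

open scoped LinearAlgebra.Projectivization Pointwise

noncomputable section

/-- The coordinate space `F⁶`. Its projectivization `ℙ F (Vec6 F)` is `PG(5,q)`. -/
abbrev Vec6 (F : Type*) := Fin 6 → F

/-- The symmetric matrix `M_P` of the vector `(y₀, …, y₅)`. -/
def symMat {F : Type*} (y : Vec6 F) : Matrix (Fin 3) (Fin 3) F :=
  !![y 0, y 1, y 2;
     y 1, y 3, y 4;
     y 2, y 4, y 5]

/-- The group of all linear maps of `F⁶` of the form `M ↦ A M Aᵀ` with `A ∈ GL(3,q)`. It acts on
the subspaces of `PG(5,q)` as the lift `K` of `PGL(3,q)` through the Veronese map (scalars act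
trivially on subspaces). -/
def groupK (F : Type*) [Field F] : Subgroup (Vec6 F ≃ₗ[F] Vec6 F) where
  carrier := {g | ∃ A : GL (Fin 3) F, ∀ y : Vec6 F,
    symMat (g y) = (A : Matrix (Fin 3) (Fin 3) F) * symMat y *
      (A : Matrix (Fin 3) (Fin 3) F).transpose}
  one_mem' := ⟨1, fun y => by simp⟩
  mul_mem' := by
    rintro g h ⟨A, hA⟩ ⟨B, hB⟩
    refine ⟨A * B, fun y => ?_⟩
    rw [LinearEquiv.mul_apply, hA, hB]
    simp [Matrix.transpose_mul, Matrix.mul_assoc]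
  inv_mem' := by
    rintro g ⟨A, hA⟩
    refine ⟨A⁻¹, fun y => ?_⟩
    have h := hA (g⁻¹ y)
    have h2 : g (g⁻¹ y) = y := LinearEquiv.apply_symm_apply g y
    rw [h2] at h
    have h3 : ((A⁻¹ : GL (Fin 3) F) : Matrix (Fin 3) (Fin 3) F) *
        (A : Matrix (Fin 3) (Fin 3) F) = 1 := by
      rw [← Units.val_mul]; simp
    have h4 : (A : Matrix (Fin 3) (Fin 3) F).transpose *
        ((A⁻¹ : GL (Fin 3) F) : Matrix (Fin 3) (Fin 3) F).transpose = 1 := by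
      rw [← Matrix.transpose_mul, h3, Matrix.transpose_one]
    rw [h, Matrix.mul_assoc, Matrix.mul_assoc, Matrix.mul_assoc, h4, Matrix.mul_one,
      ← Matrix.mul_assoc, h3, Matrix.one_mul]

/-- The rank of a point of `PG(5,q)`. -/
def pointRank {F : Type*} [Field F] (P : ℙ F (Vec6 F)) : ℕ := (symMat P.rep).rank

/-- The nucleus plane `Z(Y₀, Y₃, Y₅)`, for `q` even. -/
def nucleusPlane (F : Type*) [Field F] : Set (ℙ F (Vec6 F)) :=
  {P | P.rep 0 = 0 ∧ P.rep 3 = 0 ∧ P.rep 5 = 0}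

/-- Points of rank one. -/
def P1 (F : Type*) [Field F] : Set (ℙ F (Vec6 F)) := {P | pointRank P = 1}

/-- Points of rank two in the nucleus plane. -/
def P2n (F : Type*) [Field F] : Set (ℙ F (Vec6 F)) :=
  {P | pointRank P = 2 ∧ P ∈ nucleusPlane F}

/-- Points of rank two not in the nucleus plane. -/
def P2s (F : Type*) [Field F] : Set (ℙ F (Vec6 F)) :=
  {P | pointRank P = 2 ∧ P ∉ nucleusPlane F}

/-- Points of rank three. -/
def P3 (F : Type*) [Field F] : Set (ℙ F (Vec6 F)) := {P | pointRank P = 3}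

/-- The linear form `ℓ₀X₀ + ℓ₁X₁ + ℓ₂X₂`. -/
def linForm {F : Type*} [Field F] (l : Fin 3 → F) : MvPolynomial (Fin 3) F :=
  ∑ i, MvPolynomial.C (l i) * MvPolynomial.X i

/-- The quadratic form `a₀₀X₀² + a₀₁X₀X₁ + a₀₂X₀X₂ + a₁₁X₁² + a₁₂X₁X₂ + a₂₂X₂²` with coefficient
vector `a = (a₀₀, a₀₁, a₀₂, a₁₁, a₁₂, a₂₂)`. Nonzero forms up to scalars, that is, the points of
`ℙ F (Vec6 F)` read as coefficient vectors, are the conics of `PG(2,q)`. -/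
def quadForm {F : Type*} [Field F] (a : Vec6 F) : MvPolynomial (Fin 3) F :=
  MvPolynomial.C (a 0) * MvPolynomial.X 0 ^ 2
    + MvPolynomial.C (a 1) * (MvPolynomial.X 0 * MvPolynomial.X 1)
    + MvPolynomial.C (a 2) * (MvPolynomial.X 0 * MvPolynomial.X 2)
    + MvPolynomial.C (a 3) * MvPolynomial.X 1 ^ 2
    + MvPolynomial.C (a 4) * (MvPolynomial.X 1 * MvPolynomial.X 2)
    + MvPolynomial.C (a 5) * MvPolynomial.X 2 ^ 2

/-- The discriminant of a quadratic form. -/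
def disc {F : Type*} [Field F] (a : Vec6 F) : F :=
  4 * a 0 * a 3 * a 5 + a 1 * a 2 * a 4 - a 0 * a 4 ^ 2 - a 3 * a 2 ^ 2 - a 5 * a 1 ^ 2

/-- Double lines. -/
def doubleLines (F : Type*) [Field F] : Set (ℙ F (Vec6 F)) :=
  {C | ∃ (c : F) (l : Fin 3 → F), c ≠ 0 ∧ l ≠ 0 ∧
    quadForm C.rep = MvPolynomial.C c * linForm l ^ 2}

/-- Pairs of distinct (real) lines. -/
def realPairs (F : Type*) [Field F] : Set (ℙ F (Vec6 F)) :=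
  {C | ∃ l m : Fin 3 → F, LinearIndependent F ![l, m] ∧
    quadForm C.rep = linForm l * linForm m}

/-- Pairs of conjugate imaginary lines: over the quadratic extension `E` of `F`, the form is, up to
a scalar of `F`, the product of two non-proportional linear forms that are conjugate under
`x ↦ x ^ q`. -/
def imaginaryPairs (F E : Type*) [Field F] [Field E] [Algebra F E] : Set (ℙ F (Vec6 F)) :=
  {C | ∃ (c : F) (l : Fin 3 → E), c ≠ 0 ∧
    LinearIndependent E ![l, fun i => l i ^ Nat.card F] ∧
    MvPolynomial.map (algebraMap F E) (quadForm C.rep) =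
      MvPolynomial.C (algebraMap F E c) * linForm l * linForm (fun i => l i ^ Nat.card F)}

/-- Non-singular conics. -/
def nonsingularConics (F : Type*) [Field F] : Set (ℙ F (Vec6 F)) := {C | disc C.rep ≠ 0}

/-- The four types of conics, in the order: double lines, real pairs of lines, imaginary pairs of
lines, non-singular conics. -/
def conicType (F E : Type*) [Field F] [Field E] [Algebra F E] : Fin 4 → Set (ℙ F (Vec6 F)) :=
  ![doubleLines F, realPairs F, imaginaryPairs F E, nonsingularConics F]

/-- The hyperplane `δ(C)` of `PG(5,q)` with equation
`a₀₀Y₀ + a₀₁Y₁ + a₀₂Y₂ + a₁₁Y₃ + a₁₂Y₄ + a₂₂Y₅ = 0`. -/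
def hyperplaneOf {F : Type*} [Field F] (C : ℙ F (Vec6 F)) : Submodule F (Vec6 F) :=
  LinearMap.ker (∑ i, C.rep i • (LinearMap.proj i : Vec6 F →ₗ[F] F))

/-- The sets `ℋ₁, ℋ₂ᵣ, ℋ₂ᵢ, ℋ₃` of hyperplanes of `PG(5,q)` that correspond to the four types of
conics. -/
def hyperplaneType (F E : Type*) [Field F] [Field E] [Algebra F E] (i : Fin 4) :
    Set (Submodule F (Vec6 F)) :=
  hyperplaneOf '' conicType F E i

/-- The hyperplane-orbit distribution `OD₄(W) = [h₁, h₂ᵣ, h₂ᵢ, h₃]` of a subspace `W`. -/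
def OD4 (F E : Type*) [Field F] [Field E] [Algebra F E] (W : Submodule F (Vec6 F)) :
    Fin 4 → ℕ :=
  fun i => Set.ncard {H | H ∈ hyperplaneType F E i ∧ W ≤ H}

/-- The linear system of conics (as a space of quadratic forms, given by their coefficient vectors)
corresponding to the point `P`: all forms `a` with `∑ aᵢ Pᵢ = 0`. -/
def squabOf {F : Type*} [Field F] (P : ℙ F (Vec6 F)) : Submodule F (Vec6 F) :=
  LinearMap.ker (∑ i, P.rep i • (LinearMap.proj i : Vec6 F →ₗ[F] F))

/-- The number of conics of each of the four types in a linear system `S` of conics. -/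
def conicDist (F E : Type*) [Field F] [Field E] [Algebra F E] (S : Submodule F (Vec6 F)) :
    Fin 4 → ℕ :=
  fun i => Set.ncard {C | C ∈ conicType F E i ∧ C.submodule ≤ S}

/-- The set of `K`-orbits of points of `PG(5,q)`. -/
def pointOrbits (F : Type*) [Field F] : Set (Set (ℙ F (Vec6 F))) :=
  {O | ∃ P : ℙ F (Vec6 F), O = MulAction.orbit (groupK F) P}

/-- The set of `K`-orbits of hyperplanes of `PG(5,q)`. -/
def hyperplaneOrbits (F : Type*) [Field F] : Set (Set (Submodule F (Vec6 F))) :=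
  {O | ∃ H : Submodule F (Vec6 F), Module.finrank F H = 5 ∧ O = MulAction.orbit (groupK F) H}

end

/-! Points are treated as vectors `y`, conics as coefficient vectors `a`, and incidence is `a ⬝ᵥ y =
0`. Congruence by `A` on points is adjoint to substitution on forms (`coact`), so types and
incidence can be transported together. Hyperplanes through `P` and conics of the squab of `P` are
then two readings of the same set of vectors `a`.

Characteristic 2 drives the classification. Every scalar is a square, so a form without mixed terms
is the square of a linear form. Any other nonzero form is `c (l m + n²)` with `l`, `m` independent
(`exists_complete_square`), with discriminant `c³ det(l, m, n)²`. If it is singular, `n` lies in the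
span of `l` and `m`; the form is then binary and splits over `F` or, with conjugate factors, over
`E`. The four types are therefore exhaustive, are disjoint, and each is one orbit up to scalars.
Dually, `l M lᵀ` is the square of a linear form in `l` whose coefficients are the square roots of
the diagonal of `M`; this yields the four normal forms of points.

All counts are made on vectors and divided by `q - 1`. Double lines solve one linear equation in the
diagonal coefficients (`ncard_formType_zero`). Real pairs come from ordered independent pairs with
`l M mᵀ = 0` (`ncard_pairs`), each product arising from `2 (q - 1)` of them. Non-singular forms are
counted at a normal form of the point, where the discriminant is affine in two of the parameters
(`ncard_pencil_ne_zero`). Conjugate pairs are what remains of the `q⁵ - 1` nonzero forms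
(`sum_ncard_formType`). -/

noncomputable section

open Matrix

/-! ### Congruence of symmetric matrices and its adjoint action on forms -/

/-- The coordinates of a symmetric matrix. -/
def symCoords {F : Type*} (M : Matrix (Fin 3) (Fin 3) F) : Vec6 F :=
  ![M 0 0, M 0 1, M 0 2, M 1 1, M 1 2, M 2 2]

theorem symCoords_symMat {F : Type*} (y : Vec6 F) : symCoords (symMat y) = y := by
  ext i; fin_cases i <;> rfl

theorem symMat_injective {F : Type*} : Function.Injective (symMat : Vec6 F → _) :=
  Function.LeftInverse.injective symCoords_symMat

theorem symMat_symCoords {F : Type*} {M : Matrix (Fin 3) (Fin 3) F} (hM : M.transpose = M) :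
    symMat (symCoords M) = M := by
  have h : ∀ i j, M j i = M i j := fun i j => congrFun (congrFun hM i) j
  ext i j
  fin_cases i <;> fin_cases j <;> simp [symMat, symCoords, h 0 1, h 0 2, h 1 2]

theorem symMat_transpose {F : Type*} (y : Vec6 F) : (symMat y).transpose = symMat y := by
  ext i j; fin_cases i <;> fin_cases j <;> rfl

theorem symMat_add {F : Type*} [Field F] (y z : Vec6 F) :
    symMat (y + z) = symMat y + symMat z := by
  ext i j; fin_cases i <;> fin_cases j <;> rfl

theorem symMat_smul {F : Type*} [Field F] (c : F) (y : Vec6 F) :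
    symMat (c • y) = c • symMat y := by
  ext i j; fin_cases i <;> fin_cases j <;> rfl

/-- The congruence `M ↦ A M Aᵀ` in coordinates. -/
def congrLin {F : Type*} [Field F] (A : Matrix (Fin 3) (Fin 3) F) : Vec6 F →ₗ[F] Vec6 F where
  toFun y := symCoords (A * symMat y * A.transpose)
  map_add' y z := by
    rw [symMat_add, Matrix.mul_add, Matrix.add_mul]
    ext i; fin_cases i <;> rfl
  map_smul' c y := by
    rw [symMat_smul, Matrix.mul_smul, Matrix.smul_mul]
    ext i; fin_cases i <;> rfl

theorem symMat_congrLin {F : Type*} [Field F] (A : Matrix (Fin 3) (Fin 3) F) (y : Vec6 F) :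
    symMat (congrLin A y) = A * symMat y * A.transpose :=
  symMat_symCoords (by simp [Matrix.transpose_mul, symMat_transpose, Matrix.mul_assoc])

theorem congrLin_mul {F : Type*} [Field F] (A B : Matrix (Fin 3) (Fin 3) F) (y : Vec6 F) :
    congrLin (A * B) y = congrLin A (congrLin B y) :=
  symMat_injective (by simp [symMat_congrLin, Matrix.transpose_mul, Matrix.mul_assoc])

theorem congrLin_one {F : Type*} [Field F] (y : Vec6 F) : congrLin 1 y = y :=
  symMat_injective (by simp [symMat_congrLin])

/-- The congruence by an invertible matrix as a linear equivalence. -/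
def congrEquiv {F : Type*} [Field F] (A : GL (Fin 3) F) : Vec6 F ≃ₗ[F] Vec6 F :=
  { congrLin (A : Matrix (Fin 3) (Fin 3) F) with
    invFun := congrLin ((A⁻¹ : GL (Fin 3) F) : Matrix (Fin 3) (Fin 3) F)
    left_inv := fun y => by
      change congrLin _ (congrLin _ y) = y
      rw [← congrLin_mul, ← Units.val_mul, inv_mul_cancel, Units.val_one, congrLin_one]
    right_inv := fun y => by
      change congrLin _ (congrLin _ y) = y
      rw [← congrLin_mul, ← Units.val_mul, mul_inv_cancel, Units.val_one, congrLin_one] }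

theorem congrEquiv_apply {F : Type*} [Field F] (A : GL (Fin 3) F) (y : Vec6 F) :
    congrEquiv A y = congrLin (A : Matrix (Fin 3) (Fin 3) F) y := rfl

theorem congrEquiv_mem {F : Type*} [Field F] (A : GL (Fin 3) F) : congrEquiv A ∈ groupK F :=
  ⟨A, fun y => symMat_congrLin _ y⟩

theorem exists_congrEquiv_eq {F : Type*} [Field F] {g : Vec6 F ≃ₗ[F] Vec6 F}
    (hg : g ∈ groupK F) : ∃ A : GL (Fin 3) F, g = congrEquiv A := by
  obtain ⟨A, hA⟩ := hg
  refine ⟨A, LinearEquiv.ext fun y => symMat_injective ?_⟩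
  rw [hA, congrEquiv_apply, symMat_congrLin]

/-- The action on quadratic forms that is adjoint to the congruence by `A`. -/
def coact {F : Type*} [Field F] (A : Matrix (Fin 3) (Fin 3) F) : Vec6 F →ₗ[F] Vec6 F :=
  Matrix.toLin' (LinearMap.toMatrix' (congrLin A)).transpose

/-- Beyond linearity, this adjunction is all that is ever used about `coact`: identities of forms
are checked by pairing with every `y`. -/
theorem coact_dotProduct {F : Type*} [Field F] (A : Matrix (Fin 3) (Fin 3) F) (a y : Vec6 F) :
    coact A a ⬝ᵥ y = a ⬝ᵥ congrLin A y := by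
  rw [coact, Matrix.toLin'_apply, Matrix.mulVec_transpose, ← Matrix.dotProduct_mulVec,
    LinearMap.toMatrix'_mulVec]

theorem coact_mul {F : Type*} [Field F] (A B : Matrix (Fin 3) (Fin 3) F) (a : Vec6 F) :
    coact (A * B) a = coact B (coact A a) :=
  dotProduct_eq _ _ fun y => by simp only [coact_dotProduct, congrLin_mul]

theorem coact_one {F : Type*} [Field F] (a : Vec6 F) :
    coact 1 a = a :=
  dotProduct_eq _ _ fun y => by simp only [coact_dotProduct, congrLin_one]

theorem coact_inv_coact {F : Type*} [Field F] (A : GL (Fin 3) F) (a : Vec6 F) :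
    coact ((A⁻¹ : GL (Fin 3) F) : Matrix (Fin 3) (Fin 3) F)
      (coact (A : Matrix (Fin 3) (Fin 3) F) a) = a := by
  rw [← coact_mul, ← Units.val_mul, mul_inv_cancel, Units.val_one, coact_one]

theorem coact_coact_inv {F : Type*} [Field F] (A : GL (Fin 3) F) (a : Vec6 F) :
    coact (A : Matrix (Fin 3) (Fin 3) F)
      (coact ((A⁻¹ : GL (Fin 3) F) : Matrix (Fin 3) (Fin 3) F) a) = a := by
  rw [← coact_mul, ← Units.val_mul, inv_mul_cancel, Units.val_one, coact_one]

theorem coact_ne_zero {F : Type*} [Field F] (A : GL (Fin 3) F) {a : Vec6 F} (ha : a ≠ 0) :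
    coact (A : Matrix (Fin 3) (Fin 3) F) a ≠ 0 := fun h =>
  ha (by rw [← coact_inv_coact A a, h, map_zero])

/-! ### Products of linear forms and types of coefficient vectors -/

/-- The coefficient vector of the product of two linear forms. -/
def prodVec {F : Type*} [Field F] (l m : Fin 3 → F) : Vec6 F :=
  ![l 0 * m 0, l 0 * m 1 + l 1 * m 0, l 0 * m 2 + l 2 * m 0, l 1 * m 1,
    l 1 * m 2 + l 2 * m 1, l 2 * m 2]

theorem prodVec_dotProduct {F : Type*} [Field F] (l m : Fin 3 → F) (y : Vec6 F) :
    prodVec l m ⬝ᵥ y = l ⬝ᵥ symMat y *ᵥ m := by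
  simp [prodVec, symMat, dotProduct, Fin.sum_univ_succ, Matrix.mulVec]
  ring

theorem prodVec_smul_left {F : Type*} [Field F] (c : F) (l m : Fin 3 → F) :
    prodVec (c • l) m = c • prodVec l m :=
  dotProduct_eq _ _ fun y => by simp [prodVec_dotProduct]

theorem prodVec_smul_right {F : Type*} [Field F] (c : F) (l m : Fin 3 → F) :
    prodVec l (c • m) = c • prodVec l m :=
  dotProduct_eq _ _ fun y => by simp [prodVec_dotProduct, Matrix.mulVec_smul]

theorem prodVec_comm {F : Type*} [Field F] (l m : Fin 3 → F) :
    prodVec l m = prodVec m l := by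
  ext i; fin_cases i <;> simp [prodVec] <;> ring

/-- Pairing a product with `y` gives the bilinear form of `symMat y` at `(l, m)`, so the adjoint of
congruence is the substitution by `A` in each factor. -/
theorem coact_prodVec {F : Type*} [Field F] (A : Matrix (Fin 3) (Fin 3) F) (l m : Fin 3 → F) :
    coact A (prodVec l m) = prodVec (l ᵥ* A) (m ᵥ* A) :=
  dotProduct_eq _ _ fun y => by
    rw [coact_dotProduct, prodVec_dotProduct, prodVec_dotProduct, symMat_congrLin,
      ← Matrix.mulVec_mulVec, ← Matrix.mulVec_mulVec, Matrix.dotProduct_mulVec,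
      Matrix.mulVec_transpose]

theorem quadForm_prodVec {F : Type*} [Field F] (l m : Fin 3 → F) :
    quadForm (prodVec l m) = linForm l * linForm m := by
  simp [quadForm, prodVec, linForm, Fin.sum_univ_succ]
  ring

theorem quadForm_smul {F : Type*} [Field F] (c : F) (a : Vec6 F) :
    quadForm (c • a) = MvPolynomial.C c * quadForm a := by
  simp [quadForm]
  ring

/-- The values at the unit vectors and at the sums of two of them determine all six coefficients,
even over the field with two elements. -/
theorem quadForm_injective {F : Type*} [Field F] :
    Function.Injective (quadForm : Vec6 F → MvPolynomial (Fin 3) F) := by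
  intro a b h
  have H : ∀ x : Fin 3 → F, MvPolynomial.eval x (quadForm a) = MvPolynomial.eval x (quadForm b) :=
    fun x => by rw [h]
  simp only [quadForm, map_add, map_mul, map_pow, MvPolynomial.eval_C, MvPolynomial.eval_X] at H
  have h0 := H ![1, 0, 0]
  have h3 := H ![0, 1, 0]
  have h5 := H ![0, 0, 1]
  have h1 := H ![1, 1, 0]
  have h2 := H ![1, 0, 1]
  have h4 := H ![0, 1, 1]
  simp at h0 h1 h2 h3 h4 h5
  simp only [h0, h3, h5, add_left_inj, add_right_inj] at h1 h2 h4
  ext i; fin_cases i <;> simpa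

theorem map_quadForm {F E : Type*} [Field F] [Field E] [Algebra F E] (a : Vec6 F) :
    MvPolynomial.map (algebraMap F E) (quadForm a) = quadForm (fun i => algebraMap F E (a i)) := by
  simp [quadForm]

/-- The four types of nonzero quadratic forms: squares of lines, products of two lines, products of
two conjugate lines, and non-singular forms. -/
def formType (F E : Type*) [Field F] [Field E] [Algebra F E] : Fin 4 → Set (Vec6 F) :=
  ![{a | ∃ (c : F) (l : Fin 3 → F), c ≠ 0 ∧ l ≠ 0 ∧ a = c • prodVec l l},
    {a | ∃ l m : Fin 3 → F, LinearIndependent F ![l, m] ∧ a = prodVec l m},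
    {a | ∃ (c : F) (l : Fin 3 → E), c ≠ 0 ∧
      LinearIndependent E ![l, fun i => l i ^ Nat.card F] ∧
      (fun i => algebraMap F E (a i)) =
        algebraMap F E c • prodVec l (fun i => l i ^ Nat.card F)},
    {a | disc a ≠ 0}]

theorem mem_conicType_iff {F E : Type*} [Field F] [Field E] [Algebra F E] (i : Fin 4)
    (C : ℙ F (Vec6 F)) : C ∈ conicType F E i ↔ C.rep ∈ formType F E i := by
  fin_cases i
  · simp only [conicType, formType, doubleLines, Fin.zero_eta, Matrix.cons_val_zero,
      Set.mem_ofPred_eq, pow_two, ← quadForm_prodVec, ← quadForm_smul, quadForm_injective.eq_iff]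
  · simp [conicType, formType, realPairs, ← quadForm_prodVec, quadForm_injective.eq_iff]
  · simp [conicType, formType, imaginaryPairs, mul_assoc, ← quadForm_prodVec, ← quadForm_smul,
      map_quadForm, quadForm_injective.eq_iff]
  · rfl

/-- Squaring is the Frobenius map, which is bijective on a finite field of characteristic 2. -/
theorem exists_sq_eq {F : Type*} [Field F] [Finite F] [CharP F 2] (x : F) : ∃ y : F, y ^ 2 = x := by
  obtain ⟨y, hy⟩ := FiniteField.isSquare_of_char_two (ringChar.eq F 2 ▸ rfl) x
  exact ⟨y, by rw [hy, pow_two]⟩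

/-! ### Conjugation, trace and norm in the quadratic extension -/

section Conjugation

variable {F E : Type*} [Field F] [Field E] [Algebra F E]

theorem exists_not_mem_range (hE : Module.finrank F E = 2) :
    ∃ x : E, x ∉ Set.range (algebraMap F E) := by
  by_contra! h
  have h1 := Algebra.finrank_eq_one_iff_bijective_algebraMap (F := F) (E := E)
  have := h1.2 ⟨(algebraMap F E).injective, h⟩
  omega

theorem exists_add_mul_eq (hE : Module.finrank F E = 2) {w : E}
    (hw : w ∉ Set.range (algebraMap F E)) (x : E) :
    ∃ u v : F, x = algebraMap F E u + w * algebraMap F E v := by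
  have hli : LinearIndependent F ![(1 : E), w] := by
    rw [LinearIndependent.pair_iff' one_ne_zero]
    intro a ha
    exact hw ⟨a, by rw [← ha, Algebra.smul_def, mul_one]⟩
  have hs := hli.span_eq_top_of_card_eq_finrank (by simp [hE])
  have hx : x ∈ Submodule.span F (Set.range ![(1 : E), w]) := hs ▸ Submodule.mem_top
  rw [Matrix.range_cons, Matrix.range_cons, Matrix.range_empty, Set.union_empty,
    Set.singleton_union, Submodule.mem_span_pair] at hx
  obtain ⟨u, v, rfl⟩ := hx
  exact ⟨u, v, by rw [Algebra.smul_def, Algebra.smul_def, mul_one, mul_comm w]⟩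

variable [Finite F]

theorem finite_of_finrank_two (hE : Module.finrank F E = 2) : Finite E :=
  have := Module.finite_of_finrank_pos (R := F) (M := E) (by omega)
  Module.finite_of_finite F

theorem conj_add (x y : E) : (x + y) ^ Nat.card F = x ^ Nat.card F + y ^ Nat.card F := by
  have := Fintype.ofFinite F
  have h := map_add (FiniteField.frobeniusAlgHom F E) x y
  simpa only [FiniteField.coe_frobeniusAlgHom, Fintype.card_eq_nat_card] using h

theorem conj_algebraMap (x : F) : algebraMap F E x ^ Nat.card F = algebraMap F E x := by
  have := Fintype.ofFinite F
  rw [← map_pow, Nat.card_eq_fintype_card, FiniteField.pow_card]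

theorem algebraMap_trace_eq (hE : Module.finrank F E = 2) (x : E) :
    algebraMap F E (Algebra.trace F E x) = x + x ^ Nat.card F := by
  have := finite_of_finrank_two hE
  rw [FiniteField.algebraMap_trace_eq_sum_pow, hE]
  simp [Finset.sum_range_succ]

theorem algebraMap_norm_eq (hE : Module.finrank F E = 2) (x : E) :
    algebraMap F E (Algebra.norm F x) = x * x ^ Nat.card F := by
  have := finite_of_finrank_two hE
  rw [FiniteField.algebraMap_norm_eq_prod_pow, hE]
  simp [Finset.prod_range_succ]

/-- A fixed `x` would have norm `x²`. The norm is also `y²` with `y` in `F`, and squaring is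
injective on `E`, so `x` would lie in `F`. -/
theorem conj_ne_self [CharP F 2] (hE : Module.finrank F E = 2) {x : E}
    (hx : x ∉ Set.range (algebraMap F E)) : x ^ Nat.card F ≠ x := by
  intro h
  have := charP_of_injective_algebraMap (algebraMap F E).injective 2
  obtain ⟨y, hy⟩ := exists_sq_eq (Algebra.norm F x)
  refine hx ⟨y, ?_⟩
  have h2 := algebraMap_norm_eq hE x
  rw [h, ← hy, map_pow, ← pow_two] at h2
  exact CharTwo.sq_injective h2

/-- An irreducible quadratic over a finite field has a root in the quadratic extension. -/
theorem exists_root_quadratic (hE : Module.finrank F E = 2) (b c : F) :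
    ∃ x : E, x ^ 2 + algebraMap F E b * x + algebraMap F E c = 0 := by
  classical
  by_cases h : ∃ r : F, r ^ 2 + b * r + c = 0
  · obtain ⟨r, hr⟩ := h
    exact ⟨algebraMap F E r, by rw [← map_pow, ← map_mul, ← map_add, ← map_add, hr, map_zero]⟩
  open Polynomial in
  let p : F[X] := X ^ 2 + C b * X + C c
  have hdeg : p.natDegree = 2 := by
    have := Polynomial.natDegree_quadratic (a := (1 : F)) (b := b) (c := c) one_ne_zero
    simpa [p] using this
  have hm : p.Monic := by
    have := Polynomial.leadingCoeff_quadratic (a := (1 : F)) (b := b) (c := c) one_ne_zero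
    rw [Polynomial.Monic]
    simpa [p] using this
  have hp : Irreducible p := by
    rw [hm.irreducible_iff_roots_eq_zero_of_degree_le_three (by omega) (by omega)]
    refine Multiset.eq_zero_of_forall_notMem fun r hr => h ⟨r, ?_⟩
    simpa [p] using (Polynomial.mem_roots'.1 hr).2
  have := Fact.mk hp
  have := finite_of_finrank_two hE
  have hfin : Module.finrank F (AdjoinRoot p) = 2 := by
    rw [(AdjoinRoot.powerBasis hp.ne_zero).finrank, AdjoinRoot.powerBasis_dim, hdeg]
  -- The root field of `p` and `E` are finite extensions of `F` of the same degree, so the former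
  -- embeds in the latter and carries its root along.
  obtain ⟨f⟩ := FiniteField.nonempty_algHom_of_finrank_dvd (F := F) (K := AdjoinRoot p) (L := E)
    (by rw [hfin, hE])
  refine ⟨f (AdjoinRoot.root p), ?_⟩
  have h0 := congrArg f (AdjoinRoot.eval₂_root p)
  simpa [p, Polynomial.eval₂_add, ← AdjoinRoot.algebraMap_eq] using h0

end Conjugation

/-! ### Invariants separating the four types of forms -/

section FormTypes

variable {F E : Type*} [Field F] [Field E] [Algebra F E]

theorem disc_smul (c : F) (a : Vec6 F) : disc (c • a) = c ^ 3 * disc a := by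
  simp [disc]; ring

theorem disc_prodVec (l m : Fin 3 → F) : disc (prodVec l m) = 0 := by
  simp [disc, prodVec]; ring

theorem disc_map (a : Vec6 F) :
    disc (fun i => algebraMap F E (a i)) = algebraMap F E (disc a) := by
  simp only [disc, map_add, map_sub, map_mul, map_pow, map_ofNat]

/-- Polynomials over a field have no zero divisors. -/
theorem prodVec_ne_zero {l m : Fin 3 → F} (h : LinearIndependent F ![l, m]) :
    prodVec l m ≠ 0 := by
  intro h0
  have hl : l ≠ 0 := h.ne_zero 0
  have hm : m ≠ 0 := h.ne_zero 1
  have e := congrArg quadForm h0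
  rw [quadForm_prodVec] at e
  have hz : quadForm (0 : Vec6 F) = 0 := by simp [quadForm]
  have hlin : ∀ l : Fin 3 → F, linForm l = 0 → l = 0 := by
    intro l hl
    ext i
    have := congrArg (MvPolynomial.eval (Pi.single i 1)) hl
    simpa [linForm, Pi.single_apply] using this
  rw [hz, mul_eq_zero] at e
  exact e.elim (fun h => hl (hlin _ h)) (fun h => hm (hlin _ h))

/-- The vector dual to the polar form; it represents the nucleus of a non-singular conic. -/
def polarVec (a : Vec6 F) : Fin 3 → F := ![a 4, a 2, a 1]

/-- The mixed coefficients of `l m` are the 2 × 2 minors of `l`, `m` up to sign, and signs are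
invisible in characteristic 2. So the polar vector of a product vanishes exactly when the factors
are proportional. -/
theorem polarVec_prodVec [CharP F 2] (l m : Fin 3 → F) :
    polarVec (prodVec l m) = crossProduct l m := by
  ext i; fin_cases i <;> simp [polarVec, prodVec, cross_apply, CharTwo.sub_eq_add, add_comm]

/-- The form `u² + t u v + n v²` in two linear forms `u` and `v`. -/
def binForm (t n : F) (u v : Fin 3 → F) : Vec6 F :=
  prodVec u u + t • prodVec u v + n • prodVec v v

/-- Expanding `(u + w v)(u + w' v)` involves `w`, `w'` only through their sum and product, so the
form descends to `F`. -/
theorem prodVec_add_mul (t n : F) (u v : Fin 3 → F) (w w' : E)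
    (ht : algebraMap F E t = w + w') (hn : algebraMap F E n = w * w') :
    prodVec (fun i => algebraMap F E (u i) + w * algebraMap F E (v i))
      (fun i => algebraMap F E (u i) + w' * algebraMap F E (v i)) =
    fun i => algebraMap F E (binForm t n u v i) := by
  ext i; fin_cases i <;> simp [prodVec, binForm, ht, hn] <;> ring

/-- The passage from `u`, `v` to the two combinations has determinant `w' - w`, which scales the
cross product. -/
theorem linearIndependent_add_mul_iff (u v : Fin 3 → F) {w w' : E} (hw : w' ≠ w) :
    LinearIndependent E ![fun i => algebraMap F E (u i) + w * algebraMap F E (v i),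
      fun i => algebraMap F E (u i) + w' * algebraMap F E (v i)] ↔
    LinearIndependent F ![u, v] := by
  rw [← crossProduct_ne_zero_iff_linearIndependent, ← crossProduct_ne_zero_iff_linearIndependent,
    not_iff_not]
  have h : crossProduct (fun i => algebraMap F E (u i) + w * algebraMap F E (v i))
      (fun i => algebraMap F E (u i) + w' * algebraMap F E (v i)) =
      (w' - w) • fun i => algebraMap F E (crossProduct u v i) := by
    ext i; fin_cases i <;> simp [cross_apply] <;> ring
  rw [h, smul_eq_zero, or_iff_right (sub_ne_zero.2 hw), funext_iff, funext_iff]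
  simp

/-- Eliminates `E` from the description of conjugate pairs: writing `l = u + w v` over the basis `1,
w` turns the product of conjugates into a norm form whose trace and norm coefficients are fixed once
and for all. -/
theorem mem_formType_two_iff [Finite F] [CharP F 2] (hE : Module.finrank F E = 2) {w : E}
    (hw : w ∉ Set.range (algebraMap F E)) (a : Vec6 F) :
    a ∈ formType F E 2 ↔ ∃ (c : F) (u v : Fin 3 → F), c ≠ 0 ∧ LinearIndependent F ![u, v] ∧
      a = c • binForm (Algebra.trace F E w) (Algebra.norm F w) u v := by
  have key : ∀ (c : F) (u v : Fin 3 → F),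
      LinearIndependent E ![fun i => algebraMap F E (u i) + w * algebraMap F E (v i),
        fun i => (algebraMap F E (u i) + w * algebraMap F E (v i)) ^ Nat.card F] ∧
      (fun i => algebraMap F E (a i)) = algebraMap F E c •
        prodVec (fun i => algebraMap F E (u i) + w * algebraMap F E (v i))
        (fun i => (algebraMap F E (u i) + w * algebraMap F E (v i)) ^ Nat.card F) ↔
      LinearIndependent F ![u, v] ∧
        a = c • binForm (Algebra.trace F E w) (Algebra.norm F w) u v := by
    intro c u v
    simp only [conj_add, mul_pow, conj_algebraMap]
    rw [linearIndependent_add_mul_iff u v (conj_ne_self hE hw),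
      prodVec_add_mul _ _ u v w _ (algebraMap_trace_eq hE w) (algebraMap_norm_eq hE w)]
    refine and_congr_right fun _ => ?_
    simp only [funext_iff, Pi.smul_apply, smul_eq_mul, ← map_mul,
      (algebraMap F E).injective.eq_iff]
  constructor
  · rintro ⟨c, l, hc, h⟩
    choose u v huv using fun i => exists_add_mul_eq hE hw (l i)
    obtain rfl : l = fun i => algebraMap F E (u i) + w * algebraMap F E (v i) := funext huv
    exact ⟨c, u, v, hc, (key c u v).1 h⟩
  · rintro ⟨c, u, v, hc, h⟩
    exact ⟨c, _, hc, (key c u v).2 h⟩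

theorem smul_mem_formType {i : Fin 4} {a : Vec6 F} (ha : a ∈ formType F E i) {k : F}
    (hk : k ≠ 0) : k • a ∈ formType F E i := by
  fin_cases i
  · obtain ⟨c, l, hc, hl, rfl⟩ := ha
    exact ⟨k * c, l, mul_ne_zero hk hc, hl, by rw [smul_smul]⟩
  · obtain ⟨l, m, h, rfl⟩ := ha
    refine ⟨k • l, m, ?_, (prodVec_smul_left k l m).symm⟩
    rw [← crossProduct_ne_zero_iff_linearIndependent] at h ⊢
    simpa [hk] using h
  · obtain ⟨c, l, hc, hl, h⟩ := ha
    refine ⟨k * c, l, mul_ne_zero hk hc, hl, ?_⟩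
    rw [map_mul, ← smul_smul, ← h]
    ext i; simp
  · change disc (k • a) ≠ 0
    rw [disc_smul]
    exact mul_ne_zero (pow_ne_zero _ hk) ha

theorem smul_mem_formType_iff {i : Fin 4} {a : Vec6 F} {k : F}
    (hk : k ≠ 0) : k • a ∈ formType F E i ↔ a ∈ formType F E i :=
  ⟨fun h => by simpa [smul_smul, hk] using smul_mem_formType h (inv_ne_zero hk),
    fun h => smul_mem_formType h hk⟩

theorem polarVec_smul (c : F) (a : Vec6 F) : polarVec (c • a) = c • polarVec a := by
  ext i; fin_cases i <;> rfl

theorem polarVec_map (a : Vec6 F) :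
    polarVec (fun i => algebraMap F E (a i)) = fun i => algebraMap F E (polarVec a i) := by
  ext i; fin_cases i <;> rfl

/-- A form without mixed terms is the square of the linear form made of the square roots of its
coefficients. -/
theorem mem_formType_zero_iff [Finite F] [CharP F 2] {a : Vec6 F} (ha : a ≠ 0) :
    a ∈ formType F E 0 ↔ polarVec a = 0 := by
  constructor
  · rintro ⟨c, l, hc, hl, rfl⟩
    rw [polarVec_smul, polarVec_prodVec, cross_self, smul_zero]
  · intro h
    obtain ⟨x, hx⟩ := exists_sq_eq (a 0)
    obtain ⟨y, hy⟩ := exists_sq_eq (a 3)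
    obtain ⟨z, hz⟩ := exists_sq_eq (a 5)
    have h4 : a 4 = 0 := congrFun h 0
    have h2 : a 2 = 0 := congrFun h 1
    have h1 : a 1 = 0 := congrFun h 2
    have e : a = (1 : F) • prodVec ![x, y, z] ![x, y, z] := by
      ext i
      fin_cases i <;>
        simp [prodVec, ← hx, ← hy, ← hz, h1, h2, h4, mul_comm, pow_two, CharTwo.add_self_eq_zero]
    refine ⟨1, ![x, y, z], one_ne_zero, ?_, e⟩
    rintro h0
    rw [h0] at e
    apply ha
    rw [e]
    ext i; fin_cases i <;> simp [prodVec]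

theorem ne_zero_of_mem_formType {i : Fin 4} {a : Vec6 F} (ha : a ∈ formType F E i) : a ≠ 0 := by
  rintro rfl
  fin_cases i
  · obtain ⟨c, l, hc, hl, h⟩ := ha
    refine hl (funext fun i => ?_)
    have h' := h.symm
    rw [smul_eq_zero, or_iff_right hc] at h'
    have h0 : l 0 * l 0 = 0 := congrFun h' 0
    have h3 : l 1 * l 1 = 0 := congrFun h' 3
    have h5 : l 2 * l 2 = 0 := congrFun h' 5
    rw [mul_self_eq_zero] at h0 h3 h5
    fin_cases i <;> simpa
  · obtain ⟨l, m, h, h'⟩ := ha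
    exact prodVec_ne_zero h h'.symm
  · obtain ⟨c, l, hc, h, h'⟩ := ha
    have := smul_ne_zero ((map_ne_zero (algebraMap F E)).2 hc) (prodVec_ne_zero h)
    rw [← h'] at this
    exact this (by ext; simp)
  · exact ha (by simp [disc])

theorem disc_eq_zero_of_mem_formType {i : Fin 4} (hi : i ≠ 3) {a : Vec6 F}
    (ha : a ∈ formType F E i) : disc a = 0 := by
  fin_cases i
  · obtain ⟨c, l, -, -, rfl⟩ := ha
    rw [disc_smul, disc_prodVec, mul_zero]
  · obtain ⟨l, m, -, rfl⟩ := ha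
    exact disc_prodVec l m
  · obtain ⟨c, l, -, -, h⟩ := ha
    have := congrArg disc h
    rwa [disc_smul, disc_prodVec, mul_zero, disc_map, map_eq_zero] at this
  · exact absurd rfl hi

theorem polarVec_ne_zero_of_mem_formType [CharP F 2] {i : Fin 4} (hi : i = 1 ∨ i = 2) {a : Vec6 F}
    (ha : a ∈ formType F E i) : polarVec a ≠ 0 := by
  have := charP_of_injective_algebraMap (algebraMap F E).injective 2
  rcases hi with rfl | rfl
  · obtain ⟨l, m, h, rfl⟩ := ha
    rw [polarVec_prodVec]
    exact crossProduct_ne_zero_iff_linearIndependent.2 h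
  · obtain ⟨c, l, hc, h, h'⟩ := ha
    intro h0
    have := congrArg polarVec h'
    rw [polarVec_map, h0, polarVec_smul, polarVec_prodVec] at this
    refine smul_ne_zero ((map_ne_zero (algebraMap F E)).2 hc)
      (crossProduct_ne_zero_iff_linearIndependent.2 h) (this.symm.trans ?_)
    ext; simp

/-- On an `F`-rational vector `x` with `l(x) = 0` the other factorization gives `c n(x) n(x)^q = 0`,
so `n(x) = 0`. Hence `n` is a multiple of `l`, and then `n` and its conjugate are dependent. -/
theorem not_mem_formType_two_of_mem_one [Finite F] {a : Vec6 F}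
    (h1 : a ∈ formType F E 1) : a ∉ formType F E 2 := by
  obtain ⟨l, m, hlm, rfl⟩ := h1
  rintro ⟨c, n, hc, hn, h⟩
  have hl : l ≠ 0 := hlm.ne_zero 0
  have hz : ∀ x : Fin 3 → F, l ⬝ᵥ x = 0 → n ⬝ᵥ (fun i => algebraMap F E (x i)) = 0 := by
    intro x hx
    let y : Fin 3 → E := fun i => algebraMap F E (x i)
    have e1 := congrArg (fun b => MvPolynomial.eval y (quadForm b)) h
    have e2 : quadForm (fun i => algebraMap F E (prodVec l m i)) =
        linForm (fun i => algebraMap F E (l i)) * linForm (fun i => algebraMap F E (m i)) := by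
      rw [← quadForm_prodVec]
      congr 1
      ext i; fin_cases i <;> simp [prodVec]
    have ev : ∀ k : Fin 3 → E, MvPolynomial.eval y (linForm k) = k ⬝ᵥ y := by
      intro k; simp [linForm, dotProduct]
    have hly : (fun i => algebraMap F E (l i)) ⬝ᵥ y = algebraMap F E (l ⬝ᵥ x) := by
      simp [dotProduct, y]
    have hny : (fun i => n i ^ Nat.card F) ⬝ᵥ y = (n ⬝ᵥ y) ^ Nat.card F := by
      simp only [dotProduct, Fin.sum_univ_three, conj_add, mul_pow, y, conj_algebraMap]
    simp only [e2, quadForm_smul, quadForm_prodVec, map_mul, ev, hly, hx, map_zero, zero_mul,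
      MvPolynomial.eval_C, hny] at e1
    have hq : Nat.card F ≠ 0 := Nat.card_pos.ne'
    have e3 := e1.symm
    simpa [hc, hq] using e3
  have hcr : ∀ i j, algebraMap F E (l i) * n j = algebraMap F E (l j) * n i := by
    intro i j
    -- The vectors `l j • e i - l i • e j` lie on the line `l = 0`; vanishing of `n` on them says
    -- that all 2 × 2 minors of `l`, `n` are zero.
    have := hz (Pi.single i (l j) - Pi.single j (l i)) (by
      simp [dotProduct_sub, mul_comm])
    have e : (fun k => algebraMap F E ((Pi.single i (l j) - Pi.single j (l i) : Fin 3 → F) k)) =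
        Pi.single i (algebraMap F E (l j)) - Pi.single j (algebraMap F E (l i)) := by
      ext k; simp [Pi.single_apply, apply_ite (algebraMap F E)]
    rw [e] at this
    simp [dotProduct_sub] at this
    linear_combination -this
  obtain ⟨i, hi⟩ := Function.ne_iff.1 hl
  have hi' : algebraMap F E (l i) ≠ 0 := (map_ne_zero _).2 hi
  have hnj : ∀ j, n j = n i / algebraMap F E (l i) * algebraMap F E (l j) := by
    intro j
    field_simp
    linear_combination hcr i j
  refine crossProduct_ne_zero_iff_linearIndependent.2 hn ?_
  generalize n i / algebraMap F E (l i) = k at hnj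
  have : n = fun j => k * algebraMap F E (l j) := funext hnj
  subst this
  simp only [mul_pow, conj_algebraMap]
  ext i; fin_cases i <;> simp [cross_apply] <;> ring

theorem formType_disjoint [Finite F] [CharP F 2] {i j : Fin 4} {a : Vec6 F}
    (hi : a ∈ formType F E i) (hj : a ∈ formType F E j) : i = j := by
  have ha := ne_zero_of_mem_formType hi
  by_contra hne
  have h3 : i ≠ 3 ∧ j ≠ 3 := by
    constructor
    · rintro rfl; exact hi (disc_eq_zero_of_mem_formType (Ne.symm hne) hj)
    · rintro rfl; exact hj (disc_eq_zero_of_mem_formType hne hi)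
  have h0 : i ≠ 0 ∧ j ≠ 0 := by
    constructor
    · rintro rfl
      exact polarVec_ne_zero_of_mem_formType (by omega) hj ((mem_formType_zero_iff ha).1 hi)
    · rintro rfl
      exact polarVec_ne_zero_of_mem_formType (by omega) hi ((mem_formType_zero_iff ha).1 hj)
  obtain ⟨rfl, rfl⟩ | ⟨rfl, rfl⟩ : i = 1 ∧ j = 2 ∨ i = 2 ∧ j = 1 := by omega
  · exact not_mem_formType_two_of_mem_one hi hj
  · exact not_mem_formType_two_of_mem_one hj hi

end FormTypes

/-! ### The four types exhaust all forms, and each is one orbit up to scalars -/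

section Classification

variable {F E : Type*} [Field F] [Field E] [Algebra F E]

/-- If, say, `a 1 ≠ 0`, then `a 1 (X₀ + (a 4 / a 1) X₂)(X₁ + (a 2 / a 1) X₂)` has the right mixed
terms and an extra `(a 2 a 4 / a 1) X₂²`. The difference is diagonal, hence `a 1` times a square. -/
theorem exists_complete_square [Finite F] [CharP F 2] {a : Vec6 F} (ha : polarVec a ≠ 0) :
    ∃ (c : F) (l m n : Fin 3 → F), c ≠ 0 ∧ LinearIndependent F ![l, m] ∧
      a = c • (prodVec l m + prodVec n n) := by
  have h2 : (2 : F) = 0 := CharTwo.two_eq_zero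
  have hcases : a 1 ≠ 0 ∨ a 2 ≠ 0 ∨ a 4 ≠ 0 := by
    by_contra! h
    exact ha (by ext i; fin_cases i <;> simp [polarVec, h])
  rcases hcases with h | h | h
  · obtain ⟨x, hx⟩ := exists_sq_eq (a 0 / a 1)
    obtain ⟨y, hy⟩ := exists_sq_eq (a 3 / a 1)
    obtain ⟨z, hz⟩ := exists_sq_eq ((a 5 + a 2 * a 4 / a 1) / a 1)
    field_simp at hx hy hz
    refine ⟨a 1, ![1, 0, a 4 / a 1], ![0, 1, a 2 / a 1], ![x, y, z], h, ?_, ?_⟩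
    · rw [← crossProduct_ne_zero_iff_linearIndependent]
      intro h0
      simpa [cross_apply] using congrFun h0 2
    · ext i
      fin_cases i <;> simp [prodVec] <;> field_simp <;> grind
  · obtain ⟨x, hx⟩ := exists_sq_eq (a 0 / a 2)
    obtain ⟨y, hy⟩ := exists_sq_eq ((a 3 + a 1 * a 4 / a 2) / a 2)
    obtain ⟨z, hz⟩ := exists_sq_eq (a 5 / a 2)
    field_simp at hx hy hz
    refine ⟨a 2, ![1, a 4 / a 2, 0], ![0, a 1 / a 2, 1], ![x, y, z], h, ?_, ?_⟩
    · rw [← crossProduct_ne_zero_iff_linearIndependent]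
      intro h0
      simpa [cross_apply] using congrFun h0 1
    · ext i
      fin_cases i <;> simp [prodVec] <;> field_simp <;> grind
  · obtain ⟨x, hx⟩ := exists_sq_eq ((a 0 + a 1 * a 2 / a 4) / a 4)
    obtain ⟨y, hy⟩ := exists_sq_eq (a 3 / a 4)
    obtain ⟨z, hz⟩ := exists_sq_eq (a 5 / a 4)
    field_simp at hx hy hz
    refine ⟨a 4, ![a 2 / a 4, 1, 0], ![a 1 / a 4, 0, 1], ![x, y, z], h, ?_, ?_⟩
    · rw [← crossProduct_ne_zero_iff_linearIndependent]
      intro h0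
      simpa [cross_apply] using congrFun h0 0
    · ext i
      fin_cases i <;> simp [prodVec] <;> field_simp <;> grind

/-- The form is `X₀X₁ + X₂²`, of discriminant 1 up to sign, in the coordinates `l, m, n`. Thus
singularity means that `n` depends on `l` and `m`. -/
theorem disc_prodVec_add_sq [CharP F 2] (l m n : Fin 3 → F) :
    disc (prodVec l m + prodVec n n) = (Matrix.of ![l, m, n]).det ^ 2 := by
  have h2 : (2 : F) = 0 := CharTwo.two_eq_zero
  simp [disc, prodVec, Matrix.det_fin_three]
  grind

theorem binary_mem_formType [Finite F] [CharP F 2] (hE : Module.finrank F E = 2) (x z : F)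
    {l m : Fin 3 → F} (h : LinearIndependent F ![l, m]) :
    x • prodVec l l + prodVec l m + z • prodVec m m ∈ formType F E 1 ∨
    x • prodVec l l + prodVec l m + z • prodVec m m ∈ formType F E 2 := by
  have h2 : (2 : F) = 0 := CharTwo.two_eq_zero
  have hc := crossProduct_ne_zero_iff_linearIndependent.2 h
  by_cases hx : x = 0
  · left
    refine ⟨l + z • m, m, ?_, ?_⟩
    · rw [← crossProduct_ne_zero_iff_linearIndependent]
      simpa [cross_self] using hc
    · ext i; fin_cases i <;> simp [prodVec, hx] <;> ring
  by_cases hr : ∃ r : F, x * r ^ 2 + r + z = 0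
  · obtain ⟨r, hr⟩ := hr
    left
    -- In characteristic 2 the two roots of `x T² + T + z` are `r` and `r + x⁻¹`.
    refine ⟨x • l + (x * r) • m, l + (r + x⁻¹) • m, ?_, ?_⟩
    · rw [← crossProduct_ne_zero_iff_linearIndependent]
      convert hc using 1
      ext i; fin_cases i <;> simp [cross_apply] <;> field_simp <;> grind
    · ext i; fin_cases i <;> simp [prodVec] <;> field_simp <;> grind
  · right
    obtain ⟨w, hw⟩ := exists_root_quadratic hE x⁻¹ (z / x)
    have hxE : algebraMap F E x ≠ 0 := (map_ne_zero _).2 hx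
    have hwF : w ∉ Set.range (algebraMap F E) := by
      rintro ⟨r, rfl⟩
      rw [← map_pow, ← map_mul, ← map_add, ← map_add, map_eq_zero] at hw
      field_simp at hw
      exact hr ⟨r, by linear_combination hw⟩
    have := charP_of_injective_algebraMap (algebraMap F E).injective 2
    have h2E : (2 : E) = 0 := CharTwo.two_eq_zero
    -- Conjugation fixes the coefficients, so `w ^ q` is the second root. Vieta then gives trace
    -- `x⁻¹` and norm `z / x`, signs being irrelevant.
    have hw' : (w ^ Nat.card F) ^ 2 + algebraMap F E x⁻¹ * w ^ Nat.card F +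
        algebraMap F E (z / x) = 0 := by
      have := congrArg (· ^ Nat.card F) hw
      simp only [conj_add, mul_pow, conj_algebraMap] at this
      rw [zero_pow Nat.card_pos.ne', pow_right_comm] at this
      exact this
    have hne := conj_ne_self hE hwF
    have ht : Algebra.trace F E w = x⁻¹ := by
      apply (algebraMap F E).injective
      rw [algebraMap_trace_eq hE]
      apply mul_right_cancel₀ (sub_ne_zero.2 hne)
      generalize w ^ Nat.card F = v at *
      linear_combination hw' - hw - algebraMap F E x⁻¹ * (v - w) * h2E
    have hn : Algebra.norm F w = z / x := by
      apply (algebraMap F E).injective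
      have ht' := congrArg (algebraMap F E) ht
      rw [algebraMap_trace_eq hE] at ht'
      rw [algebraMap_norm_eq hE]
      generalize w ^ Nat.card F = v at *
      linear_combination w * ht' - hw + w * algebraMap F E x⁻¹ * h2E
    rw [mem_formType_two_iff hE hwF]
    refine ⟨x, l, m, hx, h, ?_⟩
    rw [binForm, ht, hn]
    ext i; simp; field_simp

theorem exists_mem_formType [Finite F] [CharP F 2] (hE : Module.finrank F E = 2) {a : Vec6 F}
    (ha : a ≠ 0) : ∃ i, a ∈ formType F E i := by
  by_cases hp : polarVec a = 0
  · exact ⟨0, (mem_formType_zero_iff ha).2 hp⟩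
  by_cases hd : disc a = 0
  · obtain ⟨c, l, m, n, hc, hlm, rfl⟩ := exists_complete_square hp
    rw [disc_smul, disc_prodVec_add_sq, mul_eq_zero, or_iff_right (pow_ne_zero _ hc),
      sq_eq_zero_iff] at hd
    obtain ⟨s, t, rfl⟩ : ∃ s t : F, n = s • l + t • m := by
      have hnl : ¬ LinearIndependent F ![l, m, n] := by
        intro hli
        have := (Matrix.linearIndependent_rows_iff_isUnit (A := Matrix.of ![l, m, n])).1 hli
        rw [Matrix.isUnit_iff_isUnit_det, hd] at this
        exact not_isUnit_zero this
      have hs : (![l, m, n] : Fin 3 → Fin 3 → F) = Fin.snoc ![l, m] n := by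
        ext i j; fin_cases i <;> rfl
      rw [hs, linearIndependent_finSnoc, not_and, not_not] at hnl
      have := hnl hlm
      rw [Matrix.range_cons, Matrix.range_cons, Matrix.range_empty, Set.union_empty,
        Set.singleton_union, Submodule.mem_span_pair] at this
      obtain ⟨s, t, h⟩ := this
      exact ⟨s, t, h.symm⟩
    have h2 : (2 : F) = 0 := CharTwo.two_eq_zero
    -- The mixed term `2 s t l m` of the square vanishes, which leaves coefficient 1 at `l m`.
    have e : prodVec l m + prodVec (s • l + t • m) (s • l + t • m) =
        s ^ 2 • prodVec l l + prodVec l m + t ^ 2 • prodVec m m := by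
      ext i; fin_cases i <;> simp [prodVec] <;> grind
    rw [e]
    rcases binary_mem_formType hE (s ^ 2) (t ^ 2) hlm with h | h
    · exact ⟨1, smul_mem_formType h hc⟩
    · exact ⟨2, smul_mem_formType h hc⟩
  · exact ⟨3, hd⟩

theorem linearIndependent_vecMul (A : GL (Fin 3) F) {l m : Fin 3 → F}
    (h : LinearIndependent F ![l, m]) :
    LinearIndependent F ![l ᵥ* (A : Matrix (Fin 3) (Fin 3) F), m ᵥ* (A : Matrix _ _ F)] := by
  have hA : LinearMap.ker (Matrix.vecMulLinear (A : Matrix (Fin 3) (Fin 3) F)) = ⊥ :=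
    LinearMap.ker_eq_bot.2 (Matrix.vecMul_injective_of_isUnit A.isUnit)
  have e : ![l ᵥ* (A : Matrix (Fin 3) (Fin 3) F), m ᵥ* (A : Matrix (Fin 3) (Fin 3) F)] =
      Matrix.vecMulLinear (A : Matrix (Fin 3) (Fin 3) F) ∘ ![l, m] := by
    ext i j; fin_cases i <;> rfl
  rw [e]
  exact h.map' _ hA

theorem coact_binForm (A : Matrix (Fin 3) (Fin 3) F) (t n : F) (u v : Fin 3 → F) :
    coact A (binForm t n u v) = binForm t n (u ᵥ* A) (v ᵥ* A) := by
  simp [binForm, coact_prodVec]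

theorem coact_mem_formType_of_ne [Finite F] [CharP F 2] (hE : Module.finrank F E = 2)
    (A : GL (Fin 3) F) {i : Fin 4} (hi : i ≠ 3) {a : Vec6 F} (ha : a ∈ formType F E i) :
    coact (A : Matrix (Fin 3) (Fin 3) F) a ∈ formType F E i := by
  fin_cases i
  · obtain ⟨c, l, hc, hl, rfl⟩ := ha
    refine ⟨c, l ᵥ* (A : Matrix (Fin 3) (Fin 3) F), hc, ?_, by rw [map_smul, coact_prodVec]⟩
    intro h
    exact hl (Matrix.vecMul_injective_of_isUnit A.isUnit (by simpa using h))
  · obtain ⟨l, m, h, rfl⟩ := ha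
    exact ⟨_, _, linearIndependent_vecMul A h, coact_prodVec _ l m⟩
  · obtain ⟨w, hw⟩ := exists_not_mem_range hE
    obtain ⟨c, u, v, hc, h, rfl⟩ := (mem_formType_two_iff hE hw a).1 ha
    exact (mem_formType_two_iff hE hw _).2
      ⟨c, _, _, hc, linearIndependent_vecMul A h, by rw [map_smul, coact_binForm]⟩
  · exact absurd rfl hi

/-- For non-singular forms no transformation rule for `disc` is needed: if the image had another
type, that type would be preserved under `A⁻¹`, contradicting disjointness. -/
theorem coact_mem_formType [Finite F] [CharP F 2] (hE : Module.finrank F E = 2)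
    (A : GL (Fin 3) F) {i : Fin 4} {a : Vec6 F} (ha : a ∈ formType F E i) :
    coact (A : Matrix (Fin 3) (Fin 3) F) a ∈ formType F E i := by
  by_cases hi : i = 3
  · obtain ⟨j, hj⟩ := exists_mem_formType hE (coact_ne_zero A (ne_zero_of_mem_formType ha))
    by_cases hj3 : j = 3
    · rwa [hi, ← hj3]
    · have := coact_mem_formType_of_ne hE A⁻¹ hj3 hj
      rw [coact_inv_coact] at this
      exact absurd ((formType_disjoint this ha).trans hi) hj3
  · exact coact_mem_formType_of_ne hE A hi ha

/-- Representatives of the four types of forms; `w` generates the quadratic extension. -/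
def formRep (F : Type*) {E : Type*} [Field F] [Field E] [Algebra F E] (w : E) : Fin 4 → Vec6 F :=
  ![prodVec (Pi.single 0 1) (Pi.single 0 1), prodVec (Pi.single 0 1) (Pi.single 1 1),
    binForm (Algebra.trace F E w) (Algebra.norm F w) (Pi.single 0 1) (Pi.single 1 1),
    prodVec (Pi.single 0 1) (Pi.single 1 1) + prodVec (Pi.single 2 1) (Pi.single 2 1)]

theorem exists_gl_of_linearIndependent {l m n : Fin 3 → F}
    (h : LinearIndependent F ![l, m, n]) :
    ∃ A : GL (Fin 3) F, (A : Matrix (Fin 3) (Fin 3) F) = Matrix.of ![l, m, n] := by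
  have := (Matrix.linearIndependent_rows_iff_isUnit (A := Matrix.of ![l, m, n])).1 h
  exact ⟨this.unit, this.unit_spec⟩

theorem exists_gl_of_pair {l m : Fin 3 → F} (h : LinearIndependent F ![l, m]) :
    ∃ A : GL (Fin 3) F, Pi.single 0 1 ᵥ* (A : Matrix (Fin 3) (Fin 3) F) = l ∧
      Pi.single 1 1 ᵥ* (A : Matrix (Fin 3) (Fin 3) F) = m := by
  obtain ⟨n, hn⟩ := exists_linearIndependent_snoc_of_lt_finrank h (by simp)
  have hs : (![l, m, n] : Fin 3 → Fin 3 → F) = Fin.snoc ![l, m] n := by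
    ext i j; fin_cases i <;> rfl
  rw [← hs] at hn
  obtain ⟨A, hA⟩ := exists_gl_of_linearIndependent hn
  refine ⟨A, ?_, ?_⟩ <;> rw [Matrix.single_one_vecMul, hA] <;> rfl

theorem exists_linearIndependent_pair {l : Fin 3 → F} (h : l ≠ 0) :
    ∃ m, LinearIndependent F ![l, m] :=
  exists_linearIndependent_pair_of_one_lt_finrank (by simp) h

/-- Each type is given, up to a scalar, by one, two or three independent linear forms, and an
invertible matrix carries unit vectors to them. -/
theorem exists_eq_coact_formRep [Finite F] [CharP F 2] (hE : Module.finrank F E = 2) {w : E}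
    (hw : w ∉ Set.range (algebraMap F E)) {i : Fin 4} {a : Vec6 F} (ha : a ∈ formType F E i) :
    ∃ (A : GL (Fin 3) F) (c : F), c ≠ 0 ∧
      a = c • coact (A : Matrix (Fin 3) (Fin 3) F) (formRep F w i) := by
  fin_cases i
  · obtain ⟨c, l, hc, hl, rfl⟩ := ha
    obtain ⟨m, hm⟩ := exists_linearIndependent_pair hl
    obtain ⟨A, hA, -⟩ := exists_gl_of_pair hm
    exact ⟨A, c, hc, by simp [formRep, coact_prodVec, hA]⟩
  · obtain ⟨l, m, h, rfl⟩ := ha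
    obtain ⟨A, hA, hA'⟩ := exists_gl_of_pair h
    exact ⟨A, 1, one_ne_zero, by simp [formRep, coact_prodVec, hA, hA']⟩
  · obtain ⟨c, u, v, hc, h, rfl⟩ := (mem_formType_two_iff hE hw a).1 ha
    obtain ⟨A, hA, hA'⟩ := exists_gl_of_pair h
    exact ⟨A, c, hc, by simp [formRep, coact_binForm, hA, hA']⟩
  · have hp : polarVec a ≠ 0 := by
      intro h
      have := (mem_formType_zero_iff (E := E) (ne_zero_of_mem_formType ha)).2 h
      exact absurd (formType_disjoint ha this) (by decide)
    obtain ⟨c, l, m, n, hc, hlm, rfl⟩ := exists_complete_square hp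
    have hd : disc (c • (prodVec l m + prodVec n n)) ≠ 0 := ha
    rw [disc_smul, disc_prodVec_add_sq] at hd
    have hdet : (Matrix.of ![l, m, n]).det ≠ 0 := fun h => hd (by simp [h])
    have hu : IsUnit (Matrix.of ![l, m, n]) := by
      rw [Matrix.isUnit_iff_isUnit_det]; exact isUnit_iff_ne_zero.2 hdet
    refine ⟨hu.unit, c, hc, ?_⟩
    have h0 : (hu.unit : Matrix (Fin 3) (Fin 3) F) = Matrix.of ![l, m, n] := hu.unit_spec
    simp only [formRep, h0]
    simp [coact_prodVec]

theorem formRep_mem [Finite F] [CharP F 2] (hE : Module.finrank F E = 2) {w : E}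
    (hw : w ∉ Set.range (algebraMap F E)) (i : Fin 4) : formRep F w i ∈ formType F E i := by
  have hli : LinearIndependent F ![(Pi.single 0 1 : Fin 3 → F), Pi.single 1 1] := by
    rw [← crossProduct_ne_zero_iff_linearIndependent]
    intro h
    simpa [cross_apply] using congrFun h 2
  fin_cases i
  · exact ⟨1, Pi.single 0 1, one_ne_zero, by simp, by simp [formRep]⟩
  · exact ⟨_, _, hli, rfl⟩
  · exact (mem_formType_two_iff hE hw _).2 ⟨1, _, _, one_ne_zero, hli, by simp [formRep]⟩
  · change disc _ ≠ 0
    simp [formRep, disc, prodVec]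

end Classification

/-! ### Hyperplanes as orthogonal spaces of forms; orbits of hyperplanes; squabs -/

section Hyperplanes

variable {F E : Type*} [Field F] [Field E] [Algebra F E]

/-- The subspace of vectors orthogonal to `a`. -/
def perp (a : Vec6 F) : Submodule F (Vec6 F) :=
  LinearMap.ker (∑ i, a i • (LinearMap.proj i : Vec6 F →ₗ[F] F))

theorem mem_perp {a y : Vec6 F} : y ∈ perp a ↔ a ⬝ᵥ y = 0 := by
  simp [perp, dotProduct]

theorem squabOf_eq_perp (P : ℙ F (Vec6 F)) : squabOf P = perp P.rep := rfl

theorem perp_smul {c : F} (hc : c ≠ 0) (a : Vec6 F) : perp (c • a) = perp a := by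
  ext y; simp [mem_perp, hc]

theorem finrank_perp {a : Vec6 F} (ha : a ≠ 0) : Module.finrank F (perp a) = 5 := by
  have hf : (∑ i, a i • (LinearMap.proj i : Vec6 F →ₗ[F] F)) ≠ 0 := by
    intro h
    obtain ⟨i, hi⟩ := Function.ne_iff.1 ha
    have := congrArg (fun f => f (Pi.single i 1)) h
    exact hi (by simpa [Pi.single_apply] using this)
  have := Module.Dual.finrank_ker_add_one_of_ne_zero hf
  rw [Module.finrank_fin_fun] at this
  exact Nat.succ_injective this

theorem exists_eq_smul_of_perp_eq {a b : Vec6 F} (ha : a ≠ 0) (hb : b ≠ 0)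
    (h : perp a = perp b) : ∃ c : F, c ≠ 0 ∧ b = c • a := by
  obtain ⟨i, hi⟩ := Function.ne_iff.1 ha
  rw [Pi.zero_apply] at hi
  have key : ∀ j, b j = b i / a i * a j := by
    intro j
    -- With a fixed coordinate `a i ≠ 0`, these vectors of `perp a` force `b` to be proportional to
    -- `a`.
    have h1 : Pi.single i (a j) - Pi.single j (a i) ∈ perp a := by
      simp [mem_perp, dotProduct_sub, mul_comm]
    rw [h, mem_perp, dotProduct_sub, dotProduct_single, dotProduct_single] at h1
    field_simp
    linear_combination -h1
  refine ⟨b i / a i, ?_, funext key⟩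
  intro h0
  exact hb (funext fun j => by rw [key, h0, zero_mul, Pi.zero_apply])

theorem exists_eq_perp {S : Submodule F (Vec6 F)} (hS : Module.finrank F S = 5) :
    ∃ a : Vec6 F, a ≠ 0 ∧ S = perp a := by
  have hlt : S < ⊤ := by
    rw [lt_top_iff_ne_top]
    rintro rfl
    rw [finrank_top, Module.finrank_fin_fun] at hS
    omega
  obtain ⟨f, hf, hle⟩ := Submodule.exists_le_ker_of_lt_top S hlt
  have hfa : f = ∑ i, f (Pi.single i 1) • (LinearMap.proj i : Vec6 F →ₗ[F] F) := by
    refine LinearMap.pi_ext' fun i => LinearMap.ext_ring ?_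
    simp [Pi.single_apply]
  have ha : (fun i => f (Pi.single i 1)) ≠ 0 := by
    intro h
    apply hf
    rw [hfa]
    exact Finset.sum_eq_zero fun i _ => by rw [show f (Pi.single i 1) = 0 from congrFun h i,
      zero_smul]
  refine ⟨_, ha, ?_⟩
  rw [hfa] at hle
  exact Submodule.eq_of_le_of_finrank_eq hle (by rw [hS]; exact (finrank_perp ha).symm)

theorem smul_perp (A : GL (Fin 3) F) (a : Vec6 F) :
    (⟨congrEquiv A, congrEquiv_mem A⟩ : groupK F) • perp a =
      perp (coact ((A⁻¹ : GL (Fin 3) F) : Matrix (Fin 3) (Fin 3) F) a) := by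
  ext y
  change y ∈ congrEquiv A • perp a ↔ _
  rw [Submodule.mem_smul_pointwise_iff_exists, mem_perp, coact_dotProduct]
  constructor
  · rintro ⟨z, hz, rfl⟩
    rw [mem_perp] at hz
    change a ⬝ᵥ (congrEquiv A).symm (congrEquiv A z) = 0
    rwa [LinearEquiv.symm_apply_apply]
  · intro h
    exact ⟨(congrEquiv A).symm y, mem_perp.2 h, (congrEquiv A).apply_symm_apply y⟩

theorem exists_smul_mk_rep {v : Vec6 F} (hv : v ≠ 0) :
    ∃ c : F, c ≠ 0 ∧ (Projectivization.mk F v hv).rep = c • v := by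
  obtain ⟨c, hc⟩ := Projectivization.exists_smul_eq_mk_rep F v hv
  exact ⟨c, c.ne_zero, hc.symm⟩

theorem perp_mk_rep {v : Vec6 F} (hv : v ≠ 0) : perp (Projectivization.mk F v hv).rep = perp v := by
  obtain ⟨c, hc, h⟩ := exists_smul_mk_rep hv
  rw [h, perp_smul hc]

theorem perp_rep_injective :
    Function.Injective (fun C : ℙ F (Vec6 F) => perp C.rep) := by
  intro C D h
  obtain ⟨c, hc, h'⟩ := exists_eq_smul_of_perp_eq C.rep_nonzero D.rep_nonzero h
  rw [← C.mk_rep, ← D.mk_rep, Projectivization.mk_eq_mk_iff']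
  exact ⟨c⁻¹, by rw [h', smul_smul, inv_mul_cancel₀ hc, one_smul]⟩

theorem mk_mem_conicType_iff {v : Vec6 F} (hv : v ≠ 0) (i : Fin 4) :
    Projectivization.mk F v hv ∈ conicType F E i ↔ v ∈ formType F E i := by
  obtain ⟨c, hc, h⟩ := exists_smul_mk_rep hv
  rw [mem_conicType_iff, h, smul_mem_formType_iff hc]

theorem hyperplaneType_eq (i : Fin 4) : hyperplaneType F E i = perp '' formType F E i := by
  ext H
  constructor
  · rintro ⟨C, hC, rfl⟩
    exact ⟨C.rep, (mem_conicType_iff i C).1 hC, rfl⟩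
  · rintro ⟨a, ha, rfl⟩
    have h0 := ne_zero_of_mem_formType ha
    exact ⟨Projectivization.mk F a h0, (mk_mem_conicType_iff h0 i).2 ha, perp_mk_rep h0⟩

theorem hyperplaneType_eq_orbit [Finite F] [CharP F 2] (hE : Module.finrank F E = 2) {i : Fin 4}
    {a : Vec6 F} (ha : a ∈ formType F E i) :
    hyperplaneType F E i = MulAction.orbit (groupK F) (perp a) := by
  obtain ⟨w, hw⟩ := exists_not_mem_range hE
  obtain ⟨A, c, hc, rfl⟩ := exists_eq_coact_formRep hE hw ha
  rw [hyperplaneType_eq, perp_smul hc]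
  ext H
  constructor
  · rintro ⟨b, hb, rfl⟩
    obtain ⟨B, d, hd, rfl⟩ := exists_eq_coact_formRep hE hw hb
    -- `smul_perp` introduces an inverse, cancelled by this one. As `coact` reverses products, `A⁻¹`
    -- acts first and brings the form back to the representative.
    refine ⟨⟨congrEquiv (A⁻¹ * B)⁻¹, congrEquiv_mem _⟩, ?_⟩
    change _ • perp _ = _
    rw [smul_perp, inv_inv, perp_smul hd, Units.val_mul, coact_mul, coact_inv_coact]
  · rintro ⟨⟨g, hg⟩, rfl⟩
    obtain ⟨B, rfl⟩ := exists_congrEquiv_eq hg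
    refine ⟨_, ?_, (smul_perp B _).symm⟩
    exact coact_mem_formType hE _ (coact_mem_formType hE _ (formRep_mem hE hw i))

theorem hyperplaneType_injective [Finite F] [CharP F 2] (hE : Module.finrank F E = 2) :
    Function.Injective (hyperplaneType F E) := by
  intro i j h
  obtain ⟨w, hw⟩ := exists_not_mem_range hE
  have hi := formRep_mem hE hw i
  rw [hyperplaneType_eq, hyperplaneType_eq] at h
  have : perp (formRep F w i) ∈ perp '' formType F E j := h ▸ ⟨_, hi, rfl⟩
  obtain ⟨b, hb, hb'⟩ := this
  obtain ⟨c, hc, hcb⟩ := exists_eq_smul_of_perp_eq (ne_zero_of_mem_formType hb)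
    (ne_zero_of_mem_formType hi) hb'
  rw [hcb] at hi
  exact formType_disjoint ((smul_mem_formType_iff hc).1 hi) hb

theorem hyperplaneOrbits_eq [Finite F] [CharP F 2] (hE : Module.finrank F E = 2) :
    hyperplaneOrbits F = Set.range (hyperplaneType F E) := by
  ext O
  constructor
  · rintro ⟨H, hH, rfl⟩
    obtain ⟨a, ha, rfl⟩ := exists_eq_perp hH
    obtain ⟨i, hi⟩ := exists_mem_formType hE ha
    exact ⟨i, hyperplaneType_eq_orbit hE hi⟩
  · rintro ⟨i, rfl⟩
    obtain ⟨w, hw⟩ := exists_not_mem_range hE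
    have hi := formRep_mem hE hw i
    exact ⟨_, finrank_perp (ne_zero_of_mem_formType hi), hyperplaneType_eq_orbit hE hi⟩

theorem ncard_hyperplaneOrbits [Finite F] [CharP F 2] (hE : Module.finrank F E = 2) :
    (hyperplaneOrbits F).ncard = 4 := by
  rw [hyperplaneOrbits_eq hE, Set.ncard_range_of_injective (hyperplaneType_injective hE)]
  simp

theorem submodule_le_perp_iff (P : ℙ F (Vec6 F)) (a : Vec6 F) :
    P.submodule ≤ perp a ↔ a ⬝ᵥ P.rep = 0 := by
  rw [Projectivization.submodule_eq, Submodule.span_singleton_le_iff_mem, mem_perp]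

theorem conicDist_squabOf (P : ℙ F (Vec6 F)) (i : Fin 4) : conicDist F E (squabOf P) i =
    {C : ℙ F (Vec6 F) | C.rep ∈ formType F E i ∧ C.rep ⬝ᵥ P.rep = 0}.ncard := by
  simp only [conicDist, squabOf_eq_perp, submodule_le_perp_iff, mem_conicType_iff,
    dotProduct_comm P.rep]

/-- A conic is determined by its hyperplane, so hyperplanes may be counted as conics. The right-hand
side is the one of `conicDist_squabOf`, whence the equality of the two distributions. -/
theorem OD4_submodule (P : ℙ F (Vec6 F)) (i : Fin 4) : OD4 F E P.submodule i =
    {C : ℙ F (Vec6 F) | C.rep ∈ formType F E i ∧ C.rep ⬝ᵥ P.rep = 0}.ncard := by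
  rw [← Set.ncard_image_of_injective _ perp_rep_injective]
  rw [OD4]
  congr 1
  ext H
  constructor
  · rintro ⟨⟨C, hC, rfl⟩, hH⟩
    exact ⟨C, ⟨(mem_conicType_iff i C).1 hC, (submodule_le_perp_iff P _).1 hH⟩, rfl⟩
  · rintro ⟨C, ⟨hC, hP⟩, rfl⟩
    exact ⟨⟨C, (mem_conicType_iff i C).2 hC, rfl⟩, (submodule_le_perp_iff P _).2 hP⟩

theorem squabOf_bijOn :
    Set.BijOn (squabOf : ℙ F (Vec6 F) → Submodule F (Vec6 F)) Set.univ
      {S | Module.finrank F S = 5} := by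
  refine ⟨fun P _ => finrank_perp P.rep_nonzero, perp_rep_injective.injOn, fun S hS => ?_⟩
  obtain ⟨a, ha, rfl⟩ := exists_eq_perp hS
  exact ⟨Projectivization.mk F a ha, trivial, perp_mk_rep ha⟩

end Hyperplanes

/-! ### Normal forms and orbits of points -/

section Points

variable {F : Type*} [Field F]

/-- The four types of points, as sets of coordinate vectors. -/
def vecType (F : Type*) [Field F] : Fin 4 → Set (Vec6 F) :=
  ![{y | (symMat y).rank = 1},
    {y | (symMat y).rank = 2 ∧ y 0 = 0 ∧ y 3 = 0 ∧ y 5 = 0},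
    {y | (symMat y).rank = 2 ∧ ¬ (y 0 = 0 ∧ y 3 = 0 ∧ y 5 = 0)},
    {y | (symMat y).rank = 3}]

/-- The four types of points. -/
def pointType (F : Type*) [Field F] : Fin 4 → Set (ℙ F (Vec6 F)) := ![P1 F, P2n F, P2s F, P3 F]

theorem mem_pointType_iff (i : Fin 4) (P : ℙ F (Vec6 F)) :
    P ∈ pointType F i ↔ P.rep ∈ vecType F i := by
  fin_cases i <;> rfl

theorem vecType_disjoint {i j : Fin 4} {y : Vec6 F} (hi : y ∈ vecType F i)
    (hj : y ∈ vecType F j) : i = j := by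
  fin_cases i <;> fin_cases j <;> simp_all [vecType]

theorem smul_mem_vecType_iff {i : Fin 4} {y : Vec6 F} {k : F} (hk : k ≠ 0) :
    k • y ∈ vecType F i ↔ y ∈ vecType F i := by
  have hr : (symMat (k • y)).rank = (symMat y).rank := by
    rw [symMat_smul, Matrix.rank_smul_of_mem_nonZeroDivisors _ (mem_nonZeroDivisors_of_ne_zero hk)]
  fin_cases i <;> simp [vecType, hr, hk]

theorem rank_congrLin (A : GL (Fin 3) F) (y : Vec6 F) :
    (symMat (congrLin (A : Matrix (Fin 3) (Fin 3) F) y)).rank = (symMat y).rank := by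
  have hA : IsUnit (A : Matrix (Fin 3) (Fin 3) F).det :=
    (Matrix.isUnit_iff_isUnit_det _).1 A.isUnit
  rw [symMat_congrLin, Matrix.rank_mul_eq_left_of_isUnit_det _ _ (by rwa [Matrix.det_transpose]),
    Matrix.rank_mul_eq_right_of_isUnit_det _ _ hA]

theorem dotProduct_symMat (y : Vec6 F) (l m : Fin 3 → F) :
    l ⬝ᵥ symMat y *ᵥ m = l 0 * m 0 * y 0 + (l 0 * m 1 + l 1 * m 0) * y 1 +
      (l 0 * m 2 + l 2 * m 0) * y 2 + l 1 * m 1 * y 3 + (l 1 * m 2 + l 2 * m 1) * y 4 +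
      l 2 * m 2 * y 5 := by
  simp [symMat, dotProduct, Fin.sum_univ_succ, Matrix.mulVec]
  ring

theorem mul_mul_transpose_apply (A M : Matrix (Fin 3) (Fin 3) F) (i j : Fin 3) :
    (A * M * A.transpose) i j = A i ⬝ᵥ M *ᵥ A j := by
  rw [Matrix.mul_assoc]
  rfl

/-- Off-diagonal entries cancel in pairs in characteristic 2. Hence congruence preserves the nucleus
plane, and over a finite field the isotropic vectors form a linear subspace. -/
theorem dotProduct_symMat_self [CharP F 2] (y : Vec6 F) (l : Fin 3 → F) :
    l ⬝ᵥ symMat y *ᵥ l = y 0 * l 0 ^ 2 + y 3 * l 1 ^ 2 + y 5 * l 2 ^ 2 := by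
  have h2 : (2 : F) = 0 := CharTwo.two_eq_zero
  rw [dotProduct_symMat]
  linear_combination (l 0 * l 1 * y 1 + l 0 * l 2 * y 2 + l 1 * l 2 * y 4) * h2

theorem congrLin_diag [CharP F 2] (A : Matrix (Fin 3) (Fin 3) F) {y : Vec6 F}
    (h : y 0 = 0 ∧ y 3 = 0 ∧ y 5 = 0) :
    congrLin A y 0 = 0 ∧ congrLin A y 3 = 0 ∧ congrLin A y 5 = 0 := by
  have key : ∀ i, (A * symMat y * A.transpose) i i = 0 := by
    intro i
    have := dotProduct_symMat_self y (A i)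
    rw [h.1, h.2.1, h.2.2] at this
    rw [mul_mul_transpose_apply]
    simpa using this
  exact ⟨key 0, key 1, key 2⟩

theorem congrLin_inv_congrLin (A : GL (Fin 3) F) (y : Vec6 F) :
    congrLin ((A⁻¹ : GL (Fin 3) F) : Matrix (Fin 3) (Fin 3) F)
      (congrLin (A : Matrix (Fin 3) (Fin 3) F) y) = y :=
  (congrEquiv A).symm_apply_apply y

theorem congrLin_diag_iff [CharP F 2] (A : GL (Fin 3) F) {y : Vec6 F} :
    (congrLin (A : Matrix (Fin 3) (Fin 3) F) y 0 = 0 ∧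
      congrLin (A : Matrix (Fin 3) (Fin 3) F) y 3 = 0 ∧
      congrLin (A : Matrix (Fin 3) (Fin 3) F) y 5 = 0) ↔ y 0 = 0 ∧ y 3 = 0 ∧ y 5 = 0 :=
  ⟨fun h => by simpa only [congrLin_inv_congrLin] using congrLin_diag (↑A⁻¹ : Matrix _ _ F) h,
    congrLin_diag _⟩

theorem congrLin_mem_vecType_iff [CharP F 2] (A : GL (Fin 3) F) {i : Fin 4} {y : Vec6 F} :
    congrLin (A : Matrix (Fin 3) (Fin 3) F) y ∈ vecType F i ↔ y ∈ vecType F i := by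
  have hr := rank_congrLin A y
  have hd := congrLin_diag_iff A (y := y)
  fin_cases i
  · exact ⟨hr.symm.trans, hr.trans⟩
  · exact and_congr (by rw [hr]) hd
  · exact and_congr (by rw [hr]) (not_congr hd)
  · exact ⟨hr.symm.trans, hr.trans⟩

/-- Representatives of the four types of points. -/
def pointRep (F : Type*) [Field F] : Fin 4 → Vec6 F :=
  ![![1, 0, 0, 0, 0, 0], ![0, 1, 0, 0, 0, 0], ![1, 1, 0, 0, 0, 0], ![1, 0, 0, 0, 1, 0]]

theorem rank_mul_diagonal [DecidableEq F] {U : Matrix (Fin 3) (Fin 3) F} (hU : IsUnit U.det) (w : Fin 3 → F) :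
    (U * Matrix.diagonal w).rank = Fintype.card {i // w i ≠ 0} := by
  rw [Matrix.rank_mul_eq_right_of_isUnit_det _ _ hU, Matrix.rank_diagonal]

theorem pointRep_mem (i : Fin 4) : pointRep F i ∈ vecType F i := by
  classical
  have h2 : Fintype.card {i : Fin 3 // (![1, 1, 0] : Fin 3 → F) i ≠ 0} = 2 := by
    rw [Fintype.card_subtype, Finset.card_filter]
    simp [Fin.sum_univ_succ]
  fin_cases i
  · have e : symMat (pointRep F 0) = Matrix.diagonal ![1, 0, 0] := by
      ext i j; fin_cases i <;> fin_cases j <;> simp [symMat, pointRep]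
    change (symMat (pointRep F 0)).rank = 1
    rw [e, Matrix.rank_diagonal, Fintype.card_subtype, Finset.card_filter]
    simp [Fin.sum_univ_succ]
  -- An invertible matrix times a diagonal one exhibits the rank as the number of nonzero diagonal
  -- entries.
  · have e : symMat (pointRep F 1) = !![0, 1, 0; 1, 0, 0; 0, 0, 1] *
        Matrix.diagonal ![1, 1, 0] := by
      ext i j; fin_cases i <;> fin_cases j <;> simp [symMat, pointRep]
    refine ⟨?_, rfl, rfl, rfl⟩
    change (symMat (pointRep F 1)).rank = 2
    rw [e, rank_mul_diagonal _ _, h2]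
    simp [Matrix.det_fin_three]
  · have e : symMat (pointRep F 2) = !![1, 1, 0; 1, 0, 0; 0, 0, 1] *
        Matrix.diagonal ![1, 1, 0] := by
      ext i j; fin_cases i <;> fin_cases j <;> simp [symMat, pointRep]
    refine ⟨?_, fun h => one_ne_zero h.1⟩
    change (symMat (pointRep F 2)).rank = 2
    rw [e, rank_mul_diagonal _ _, h2]
    simp [Matrix.det_fin_three]
  · change (symMat (pointRep F 3)).rank = 3
    rw [Matrix.rank_of_isUnit, Fintype.card_fin]
    rw [Matrix.isUnit_iff_isUnit_det]
    simp [Matrix.det_fin_three, symMat, pointRep]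

theorem exists_gl_of_det {M : Matrix (Fin 3) (Fin 3) F} (h : M.det ≠ 0) :
    ∃ A : GL (Fin 3) F, (A : Matrix (Fin 3) (Fin 3) F) = M :=
  ⟨Matrix.GeneralLinearGroup.mkOfDetNeZero M h, rfl⟩

/-- The entries of `A M Aᵀ` are the values of the bilinear form of `M` on the rows of `A`, so a
normal form amounts to a choice of basis. -/
theorem congrLin_eq_of_rows {b₀ b₁ b₂ : Fin 3 → F} {y z : Vec6 F}
    (h : ![b₀ ⬝ᵥ symMat y *ᵥ b₀, b₀ ⬝ᵥ symMat y *ᵥ b₁, b₀ ⬝ᵥ symMat y *ᵥ b₂,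
      b₁ ⬝ᵥ symMat y *ᵥ b₁, b₁ ⬝ᵥ symMat y *ᵥ b₂, b₂ ⬝ᵥ symMat y *ᵥ b₂] = z) :
    congrLin (Matrix.of ![b₀, b₁, b₂]) y = z := by
  rw [← h]
  have key := mul_mul_transpose_apply (Matrix.of ![b₀, b₁, b₂]) (symMat y)
  ext i
  fin_cases i
  exacts [key 0 0, key 0 1, key 0 2, key 1 1, key 1 2, key 2 2]

/-- A nonzero vector off the nucleus plane can be moved so that its matrix has diagonal
`(1, 0, 0)`. -/
theorem exists_congrLin_diag [Finite F] [CharP F 2] {y : Vec6 F}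
    (h : ¬ (y 0 = 0 ∧ y 3 = 0 ∧ y 5 = 0)) :
    ∃ A : GL (Fin 3) F, ∃ r s t : F,
      congrLin (A : Matrix (Fin 3) (Fin 3) F) y = ![1, r, s, 0, t, 0] := by
  have h2 : (2 : F) = 0 := CharTwo.two_eq_zero
  obtain ⟨x0, h0⟩ := exists_sq_eq (y 0)
  obtain ⟨x1, h1⟩ := exists_sq_eq (y 3)
  obtain ⟨x2, h5⟩ := exists_sq_eq (y 5)
  have hx : x0 ≠ 0 ∨ x1 ≠ 0 ∨ x2 ≠ 0 := by
    by_contra! hx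
    exact h ⟨by rw [← h0, hx.1, sq, zero_mul], by rw [← h1, hx.2.1, sq, zero_mul],
      by rw [← h5, hx.2.2, sq, zero_mul]⟩
  -- The new diagonal entries are the squares of the linear form `x0, x1, x2` at the basis vectors.
  -- It suffices to take one vector with value 1 and two in the kernel.
  have fin : ∀ b₀ b₁ b₂ : Fin 3 → F, (Matrix.of ![b₀, b₁, b₂]).det ≠ 0 →
      x0 * b₀ 0 + x1 * b₀ 1 + x2 * b₀ 2 = 1 → x0 * b₁ 0 + x1 * b₁ 1 + x2 * b₁ 2 = 0 →
      x0 * b₂ 0 + x1 * b₂ 1 + x2 * b₂ 2 = 0 → ∃ A : GL (Fin 3) F, ∃ r s t : F,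
      congrLin (A : Matrix (Fin 3) (Fin 3) F) y = ![1, r, s, 0, t, 0] := by
    intro b₀ b₁ b₂ hd e0 e1 e2
    obtain ⟨A, hA⟩ := exists_gl_of_det hd
    refine ⟨A, b₀ ⬝ᵥ symMat y *ᵥ b₁, b₀ ⬝ᵥ symMat y *ᵥ b₂, b₁ ⬝ᵥ symMat y *ᵥ b₂, ?_⟩
    have q : ∀ b : Fin 3 → F, b ⬝ᵥ symMat y *ᵥ b = (x0 * b 0 + x1 * b 1 + x2 * b 2) ^ 2 := by
      intro b
      rw [dotProduct_symMat_self, ← h0, ← h1, ← h5]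
      grind
    rw [hA]
    apply congrLin_eq_of_rows
    rw [q, q, q, e0, e1, e2]
    simp
  rcases hx with hx | hx | hx
  · refine fin ![x0⁻¹, 0, 0] ![x1 / x0, 1, 0] ![x2 / x0, 0, 1] ?_ ?_ ?_ ?_
    · simp [Matrix.det_fin_three, hx]
    all_goals simp; grind
  · refine fin ![0, x1⁻¹, 0] ![1, x0 / x1, 0] ![0, x2 / x1, 1] ?_ ?_ ?_ ?_
    · simp [Matrix.det_fin_three, hx]
    all_goals simp; grind
  · refine fin ![0, 0, x2⁻¹] ![1, 0, x0 / x2] ![0, 1, x1 / x2] ?_ ?_ ?_ ?_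
    · simp [Matrix.det_fin_three, hx]
    all_goals simp; grind

theorem exists_congrLin_eq_pointRep_of_rows {y : Vec6 F} (i : Fin 4) (b₀ b₁ b₂ : Fin 3 → F)
    (hd : (Matrix.of ![b₀, b₁, b₂]).det ≠ 0)
    (h : ![b₀ ⬝ᵥ symMat y *ᵥ b₀, b₀ ⬝ᵥ symMat y *ᵥ b₁, b₀ ⬝ᵥ symMat y *ᵥ b₂,
      b₁ ⬝ᵥ symMat y *ᵥ b₁, b₁ ⬝ᵥ symMat y *ᵥ b₂, b₂ ⬝ᵥ symMat y *ᵥ b₂] = pointRep F i) :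
    ∃ (i : Fin 4) (A : GL (Fin 3) F),
      congrLin (A : Matrix (Fin 3) (Fin 3) F) y = pointRep F i := by
  obtain ⟨A, hA⟩ := exists_gl_of_det hd
  exact ⟨i, A, hA ▸ congrLin_eq_of_rows h⟩

theorem exists_congrLin_eq_pointRep [Finite F] [CharP F 2] {y : Vec6 F} (hy : y ≠ 0) :
    ∃ (i : Fin 4) (A : GL (Fin 3) F),
      congrLin (A : Matrix (Fin 3) (Fin 3) F) y = pointRep F i := by
  have h2 : (2 : F) = 0 := CharTwo.two_eq_zero
  by_cases h : y 0 = 0 ∧ y 3 = 0 ∧ y 5 = 0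
  · obtain ⟨h0, h3, h5⟩ := h
    have hcases : y 1 ≠ 0 ∨ y 2 ≠ 0 ∨ y 4 ≠ 0 := by
      by_contra! h
      exact hy (by ext i; fin_cases i <;> simp [h, h0, h3, h5])
    rcases hcases with h | h | h
    -- The matrix is alternating, with radical spanned by `(y 4, y 2, y 1)`; the first two rows are
    -- a hyperbolic pair.
    · refine exists_congrLin_eq_pointRep_of_rows 1 ![1, 0, 0] ![0, (y 1)⁻¹, 0] ![y 4, y 2, y 1]
        (by simp [Matrix.det_fin_three, h]) ?_
      simp only [dotProduct_symMat]
      ext i; fin_cases i <;>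
        simp [pointRep, h0, h3, h5, h] <;>
        grind
    · refine exists_congrLin_eq_pointRep_of_rows 1 ![1, 0, 0] ![0, 0, (y 2)⁻¹] ![y 4, y 2, y 1]
        (by simp [Matrix.det_fin_three, h]) ?_
      simp only [dotProduct_symMat]
      ext i; fin_cases i <;>
        simp [pointRep, h0, h3, h5, h] <;>
        grind
    · refine exists_congrLin_eq_pointRep_of_rows 1 ![0, 1, 0] ![0, 0, (y 4)⁻¹] ![y 4, y 2, y 1]
        (by simp [Matrix.det_fin_three, h]) ?_
      simp only [dotProduct_symMat]
      ext i; fin_cases i <;>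
        simp [pointRep, h0, h3, h5, h] <;>
        grind
  · obtain ⟨A, r, s, t, hA⟩ := exists_congrLin_diag h
    suffices ∃ (i : Fin 4) (B : GL (Fin 3) F),
        congrLin (B : Matrix (Fin 3) (Fin 3) F) ![1, r, s, 0, t, 0] = pointRep F i by
      obtain ⟨i, B, hB⟩ := this
      exact ⟨i, B * A, by rw [Units.val_mul, congrLin_mul, hA, hB]⟩
    -- The remaining matrix has determinant `t²`, so `t ≠ 0` is the case of rank three.
    by_cases ht : t = 0
    · subst ht
      by_cases hr : r = 0
      · subst hr
        by_cases hs : s = 0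
        · subst hs
          exact ⟨0, 1, by rw [Units.val_one, congrLin_one]; rfl⟩
        · refine exists_congrLin_eq_pointRep_of_rows 2 ![1, 0, 0] ![0, 0, s⁻¹] ![0, 1, 0]
            (by simp [Matrix.det_fin_three, hs]) ?_
          simp only [dotProduct_symMat]
          ext i; fin_cases i <;>
            simp [pointRep, hs]
      · refine exists_congrLin_eq_pointRep_of_rows 2 ![1, 0, 0] ![0, r⁻¹, 0] ![0, s / r, 1]
          (by simp [Matrix.det_fin_three, hr]) ?_
        simp only [dotProduct_symMat]
        ext i; fin_cases i <;>
          simp [pointRep, hr] <;>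
          grind
    -- The first row is orthogonal to the last two unit vectors, which clears `r` and `s`.
    · refine exists_congrLin_eq_pointRep_of_rows 3 ![1, s / t, r / t] ![0, 1, 0] ![0, 0, t⁻¹]
        (by simp [Matrix.det_fin_three, ht]) ?_
      simp only [dotProduct_symMat]
      ext i; fin_cases i <;>
        simp [pointRep, ht] <;>
        grind

/-- The index of the normal form need not be tracked in the reduction: congruence preserves the
type, and types are disjoint. -/
theorem exists_congrLin_pointRep_eq [Finite F] [CharP F 2] {i : Fin 4} {y : Vec6 F} (hy : y ≠ 0)
    (hi : y ∈ vecType F i) :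
    ∃ A : GL (Fin 3) F, congrLin (A : Matrix (Fin 3) (Fin 3) F) (pointRep F i) = y := by
  obtain ⟨j, A, hA⟩ := exists_congrLin_eq_pointRep hy
  have := pointRep_mem (F := F) j
  rw [← hA, congrLin_mem_vecType_iff] at this
  obtain rfl := vecType_disjoint this hi
  exact ⟨A⁻¹, by rw [← hA, congrLin_inv_congrLin]⟩

theorem mk_mem_pointType_iff {v : Vec6 F} (hv : v ≠ 0) (i : Fin 4) :
    Projectivization.mk F v hv ∈ pointType F i ↔ v ∈ vecType F i := by
  obtain ⟨c, hc, h⟩ := exists_smul_mk_rep hv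
  rw [mem_pointType_iff, h, smul_mem_vecType_iff hc]

theorem exists_mem_vecType [Finite F] [CharP F 2] {y : Vec6 F} (hy : y ≠ 0) :
    ∃ i, y ∈ vecType F i := by
  obtain ⟨i, A, hA⟩ := exists_congrLin_eq_pointRep hy
  exact ⟨i, (congrLin_mem_vecType_iff A).1 (hA ▸ pointRep_mem i)⟩

theorem pointType_eq_orbit [Finite F] [CharP F 2] {i : Fin 4} {P : ℙ F (Vec6 F)}
    (hP : P ∈ pointType F i) : pointType F i = MulAction.orbit (groupK F) P := by
  ext Q
  induction P with | h v hv
  rw [mk_mem_pointType_iff] at hP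
  constructor
  · intro hQ
    induction Q with | h u hu
    rw [mk_mem_pointType_iff] at hQ
    obtain ⟨A, hA⟩ := exists_congrLin_pointRep_eq hv hP
    obtain ⟨B, hB⟩ := exists_congrLin_pointRep_eq hu hQ
    refine ⟨⟨congrEquiv (B * A⁻¹), congrEquiv_mem _⟩, ?_⟩
    change congrEquiv (B * A⁻¹) • Projectivization.mk F v hv = _
    rw [Projectivization.smul_mk, Projectivization.mk_eq_mk_iff']
    refine ⟨1, ?_⟩
    rw [one_smul]
    change u = congrLin ((B * A⁻¹ : GL (Fin 3) F) : Matrix (Fin 3) (Fin 3) F) v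
    rw [Units.val_mul, congrLin_mul, ← hA, congrLin_inv_congrLin, hB]
  · rintro ⟨⟨g, hg⟩, rfl⟩
    obtain ⟨B, rfl⟩ := exists_congrEquiv_eq hg
    change congrEquiv B • Projectivization.mk F v hv ∈ _
    rw [Projectivization.smul_mk, mk_mem_pointType_iff]
    exact (congrLin_mem_vecType_iff B).2 hP

theorem pointRep_ne_zero (i : Fin 4) : pointRep F i ≠ 0 := by
  intro h
  have h0 := congrFun h 0
  have h1 := congrFun h 1
  fin_cases i <;> simp [pointRep] at h0 h1

theorem pointOrbits_eq_range [Finite F] [CharP F 2] :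
    pointOrbits F = Set.range (pointType F) := by
  ext O
  constructor
  · rintro ⟨P, rfl⟩
    obtain ⟨i, hi⟩ := exists_mem_vecType P.rep_nonzero
    exact ⟨i, pointType_eq_orbit ((mem_pointType_iff i P).2 hi)⟩
  · rintro ⟨i, rfl⟩
    exact ⟨_, pointType_eq_orbit
      ((mk_mem_pointType_iff (pointRep_ne_zero i) i).2 (pointRep_mem i))⟩

theorem pointType_injective : Function.Injective (pointType F) := by
  intro i j h
  have hi := (mk_mem_pointType_iff (pointRep_ne_zero i) i).2 (pointRep_mem (F := F) i)
  rw [h, mk_mem_pointType_iff] at hi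
  exact vecType_disjoint (pointRep_mem i) hi

theorem pointOrbits_eq [Finite F] [CharP F 2] : pointOrbits F = {P1 F, P2n F, P2s F, P3 F} := by
  rw [pointOrbits_eq_range]
  ext O
  simp [pointType]
  tauto

theorem ncard_pointOrbits [Finite F] [CharP F 2] : (pointOrbits F).ncard = 4 := by
  rw [pointOrbits_eq_range, Set.ncard_range_of_injective pointType_injective]
  simp

end Points

/-! ### Counting vectors, factorizations and orthogonal pairs -/

section Counting

theorem ncard_setOf_prod {α β : Type*} [Fintype α] [Finite β] (p : α × β → Prop) :
    {x | p x}.ncard = ∑ a, {b | p (a, b)}.ncard := by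
  have e := Nat.card_congr (Equiv.subtypeProdEquivSigmaSubtype fun a b => p (a, b))
  rw [Nat.card_sigma] at e
  exact e

theorem sum_ite_eq_ncard {α : Type*} [Fintype α] (p : α → Prop) [DecidablePred p] (x y : ℚ) :
    ∑ a, (if p a then x else y) =
      ({a | p a}.ncard : ℚ) * x + ((Nat.card α : ℚ) - ({a | p a}.ncard : ℚ)) * y := by
  have h : {a | p a}.ncard = (Finset.univ.filter p).card := by
    rw [← Set.ncard_coe_finset]; simp
  have h2 := Finset.card_filter_add_card_filter_not (s := (Finset.univ : Finset α)) p
  rw [Finset.card_univ, ← Nat.card_eq_fintype_card] at h2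
  rw [Finset.sum_ite, Finset.sum_const, Finset.sum_const, h, ← h2]
  simp

variable {F : Type*} [Field F]

/-- A set of nonzero vectors stable under nonzero scalars is a union of punctured lines, each with
`q - 1` elements. -/
theorem ncard_rep_mul {T : Set (Vec6 F)} (h0 : (0 : Vec6 F) ∉ T)
    (hT : ∀ (k : F) (a : Vec6 F), k ≠ 0 → (k • a ∈ T ↔ a ∈ T)) :
    {C : ℙ F (Vec6 F) | C.rep ∈ T}.ncard * (Nat.card F - 1) = T.ncard := by
  have hu : Nat.card F - 1 = (Set.univ : Set Fˣ).ncard := by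
    rw [Set.ncard_univ, Nat.card_units]
  rw [hu, ← Set.ncard_prod]
  have himg : T = (fun x : ℙ F (Vec6 F) × Fˣ => (x.2 : F) • x.1.rep) ''
      ({C : ℙ F (Vec6 F) | C.rep ∈ T} ×ˢ Set.univ) := by
    ext a
    constructor
    · intro ha
      have hne : a ≠ 0 := by rintro rfl; exact h0 ha
      obtain ⟨c, hc, h⟩ := exists_smul_mk_rep hne
      refine ⟨(Projectivization.mk F a hne, (Units.mk0 c hc)⁻¹), ⟨?_, trivial⟩, ?_⟩
      · change (Projectivization.mk F a hne).rep ∈ T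
        rw [h, hT c a hc]
        exact ha
      · simp [h, smul_smul, hc]
    · rintro ⟨⟨C, u⟩, ⟨hC, -⟩, rfl⟩
      exact (hT _ _ u.ne_zero).2 hC
  conv_rhs => rw [himg]
  refine (Set.ncard_image_of_injective _ ?_).symm
  rintro ⟨C, u⟩ ⟨D, v⟩ h
  have h' : (u : F) • C.rep = (v : F) • D.rep := h
  obtain rfl : C = D := by
    rw [← C.mk_rep, ← D.mk_rep, Projectivization.mk_eq_mk_iff']
    refine ⟨(u : F)⁻¹ * v, ?_⟩
    rw [← smul_smul, ← h', smul_smul, inv_mul_cancel₀ u.ne_zero, one_smul]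
  have := smul_left_injective F C.rep_nonzero h'
  rw [Units.ext this]

theorem ncard_vecMul_eq_zero (y : Vec6 F) :
    {l : Fin 3 → F | l ᵥ* symMat y = 0}.ncard = Nat.card F ^ (3 - (symMat y).rank) := by
  have h2 : {l : Fin 3 → F | l ᵥ* symMat y = 0} =
      (LinearMap.ker (symMat y).mulVecLin : Set (Fin 3 → F)) := by
    ext l
    have : l ᵥ* symMat y = symMat y *ᵥ l := by rw [← symMat_transpose, Matrix.vecMul_transpose,
      symMat_transpose]
    simp [this]
  have h1 := LinearMap.finrank_range_add_finrank_ker (symMat y).mulVecLin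
  rw [Module.finrank_fin_fun] at h1
  rw [h2, ← Nat.card_coe_set_eq]
  change Nat.card (LinearMap.ker (symMat y).mulVecLin) = _
  rw [Module.natCard_eq_pow_finrank (K := F), Matrix.rank]
  congr 1
  omega

/-- The diagonal of the matrix of a point. -/
def diagVec (y : Vec6 F) : Fin 3 → F := ![y 0, y 3, y 5]

theorem diagVec_eq_zero_iff (y : Vec6 F) : diagVec y = 0 ↔ y 0 = 0 ∧ y 3 = 0 ∧ y 5 = 0 := by
  simp [diagVec]

/-- Unique factorization of `X₀X₁`, read off the six coefficients; the general case is transported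
to this one. -/
theorem prodVec_eq_single_iff {l m : Fin 3 → F}
    (h : prodVec l m = prodVec (Pi.single 0 1) (Pi.single 1 1)) :
    ∃ u : Fˣ, (l = (u : F) • Pi.single 0 1 ∧ m = ((u⁻¹ : Fˣ) : F) • Pi.single 1 1) ∨
      (l = (u : F) • Pi.single 1 1 ∧ m = ((u⁻¹ : Fˣ) : F) • Pi.single 0 1) := by
  have h0 := congrFun h 0
  have h1 := congrFun h 1
  have h2 := congrFun h 2
  have h3 := congrFun h 3
  have h4 := congrFun h 4
  have h5 := congrFun h 5
  simp [prodVec] at h0 h1 h2 h3 h4 h5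
  rcases h0 with h0 | h0
  · rw [h0, zero_mul, zero_add] at h1 h2
    have hl : l 1 ≠ 0 := left_ne_zero_of_mul_eq_one h1
    have hm : m 0 ≠ 0 := right_ne_zero_of_mul_eq_one h1
    have hm1 : m 1 = 0 := h3.resolve_left hl
    have hl2 : l 2 = 0 := (mul_eq_zero.1 h2).resolve_right hm
    rw [hl2, zero_mul, add_zero] at h4
    have hm2 : m 2 = 0 := (mul_eq_zero.1 h4).resolve_left hl
    refine ⟨Units.mk0 (l 1) hl, Or.inr ⟨?_, ?_⟩⟩
    · ext i; fin_cases i <;> simp [h0, hl2]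
    · ext i; fin_cases i <;> simp [hm1, hm2]
      exact eq_inv_of_mul_eq_one_right h1
  · rw [h0, mul_zero, add_zero] at h1 h2
    have hl : l 0 ≠ 0 := left_ne_zero_of_mul_eq_one h1
    have hm : m 1 ≠ 0 := right_ne_zero_of_mul_eq_one h1
    have hl1 : l 1 = 0 := h3.resolve_right hm
    have hm2 : m 2 = 0 := (mul_eq_zero.1 h2).resolve_left hl
    rw [hl1, zero_mul, zero_add] at h4
    have hl2 : l 2 = 0 := (mul_eq_zero.1 h4).resolve_right hm
    refine ⟨Units.mk0 (l 0) hl, Or.inl ⟨?_, ?_⟩⟩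
    · ext i; fin_cases i <;> simp [hl1, hl2]
    · ext i; fin_cases i <;> simp [h0, hm2]
      exact eq_inv_of_mul_eq_one_right h1

theorem linearIndependent_pair_smul {l m : Fin 3 → F} (h : LinearIndependent F ![l, m])
    (u v : Fˣ) : LinearIndependent F ![(u : F) • l, (v : F) • m] := by
  rw [← crossProduct_ne_zero_iff_linearIndependent] at h ⊢
  simpa using h

theorem ncard_span_singleton_inter {l : Fin 3 → F} (hl : l ≠ 0) (y : Vec6 F)
    [Decidable (l ⬝ᵥ symMat y *ᵥ l = 0)] :
    ({m : Fin 3 → F | ∃ c : F, m = c • l} ∩ {m | (l ᵥ* symMat y) ⬝ᵥ m = 0}).ncard =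
      if l ⬝ᵥ symMat y *ᵥ l = 0 then Nat.card F else 1 := by
  split_ifs with h
  · have e : ({m : Fin 3 → F | ∃ c : F, m = c • l} ∩ {m | (l ᵥ* symMat y) ⬝ᵥ m = 0}) =
        Set.range fun c : F => c • l := by
      ext m
      constructor
      · rintro ⟨⟨c, rfl⟩, -⟩
        exact ⟨c, rfl⟩
      · rintro ⟨c, rfl⟩
        refine ⟨⟨c, rfl⟩, ?_⟩
        change (l ᵥ* symMat y) ⬝ᵥ (c • l) = 0
        rw [dotProduct_smul, ← Matrix.dotProduct_mulVec, h, smul_zero]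
    rw [e, Set.ncard_range_of_injective (smul_left_injective F hl)]
  · rw [Set.ncard_eq_one]
    refine ⟨0, ?_⟩
    ext m
    constructor
    · rintro ⟨⟨c, rfl⟩, hc⟩
      change (l ᵥ* symMat y) ⬝ᵥ (c • l) = 0 at hc
      rw [dotProduct_smul, ← Matrix.dotProduct_mulVec, smul_eq_mul, mul_eq_zero,
        or_iff_left h] at hc
      simp [hc]
    · rintro rfl
      exact ⟨⟨0, by simp⟩, by simp⟩

theorem ncard_dotProduct_eq_zero (w : Fin 3 → F) [Decidable (w = 0)] :
    {d : Fin 3 → F | w ⬝ᵥ d = 0}.ncard = if w = 0 then Nat.card F ^ 3 else Nat.card F ^ 2 := by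
  split_ifs with h
  · simp [h, Set.ncard_univ, Nat.card_fun]
  · let f : Module.Dual F (Fin 3 → F) := ∑ i, w i • (LinearMap.proj i : (Fin 3 → F) →ₗ[F] F)
    have hf : f ≠ 0 := by
      intro h'
      obtain ⟨i, hi⟩ := Function.ne_iff.1 h
      have := congrArg (fun f => f (Pi.single i 1)) h'
      exact hi (by simpa [f, Pi.single_apply] using this)
    have h1 := Module.Dual.finrank_ker_add_one_of_ne_zero hf
    rw [Module.finrank_fin_fun] at h1
    have h2 : {d : Fin 3 → F | w ⬝ᵥ d = 0} = (LinearMap.ker f : Set (Fin 3 → F)) := by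
      ext d; simp [f, dotProduct]
    rw [h2, ← Nat.card_coe_set_eq]
    change Nat.card (LinearMap.ker f) = _
    rw [Module.natCard_eq_pow_finrank (K := F), Nat.succ_injective h1]

/-- Unique factorization of a product of two independent linear forms. -/
theorem prodVec_eq_prodVec_iff {l m l' m' : Fin 3 → F} (h : LinearIndependent F ![l, m]) :
    prodVec l' m' = prodVec l m ↔
      ∃ u : Fˣ, (l' = (u : F) • l ∧ m' = ((u⁻¹ : Fˣ) : F) • m) ∨
        (l' = (u : F) • m ∧ m' = ((u⁻¹ : Fˣ) : F) • l) := by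
  constructor
  · intro he
    obtain ⟨A, hl, hm⟩ := exists_gl_of_pair h
    have hA : ∀ v : Fin 3 → F, (v ᵥ* ((A⁻¹ : GL (Fin 3) F) : Matrix (Fin 3) (Fin 3) F)) ᵥ*
        (A : Matrix (Fin 3) (Fin 3) F) = v := by
      intro v
      rw [Matrix.vecMul_vecMul, ← Units.val_mul, inv_mul_cancel, Units.val_one, Matrix.vecMul_one]
    have h1 := congrArg (coact ((A⁻¹ : GL (Fin 3) F) : Matrix (Fin 3) (Fin 3) F)) he
    rw [← hl, ← hm, ← coact_prodVec _ (Pi.single 0 1), coact_inv_coact, coact_prodVec] at h1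
    obtain ⟨u, hu⟩ := prodVec_eq_single_iff h1
    refine ⟨u, hu.imp ?_ ?_⟩ <;> rintro ⟨e1, e2⟩ <;>
      rw [← hA l', ← hA m', e1, e2, Matrix.smul_vecMul, Matrix.smul_vecMul, hl, hm] <;>
      exact ⟨rfl, rfl⟩
  · rintro ⟨u, ⟨rfl, rfl⟩ | ⟨rfl, rfl⟩⟩
    · rw [prodVec_smul_left, prodVec_smul_right, smul_smul, Units.mul_inv, one_smul]
    · rw [prodVec_smul_left, prodVec_smul_right, smul_smul, Units.mul_inv, one_smul, prodVec_comm]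

variable [Finite F]

/-- The quadratic form is the square of the linear form with coefficients the square roots of the
diagonal, so only a linear equation has to be counted. -/
theorem ncard_dotProduct_self_eq_zero [CharP F 2] (y : Vec6 F) [Decidable (diagVec y = 0)] :
    {l : Fin 3 → F | l ⬝ᵥ symMat y *ᵥ l = 0}.ncard =
      if diagVec y = 0 then Nat.card F ^ 3 else Nat.card F ^ 2 := by
  classical
  have h2 : (2 : F) = 0 := CharTwo.two_eq_zero
  obtain ⟨x0, h0⟩ := exists_sq_eq (y 0)
  obtain ⟨x1, h1⟩ := exists_sq_eq (y 3)
  obtain ⟨x2, h5⟩ := exists_sq_eq (y 5)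
  have hz : diagVec y = 0 ↔ ![x0, x1, x2] = 0 := by
    rw [diagVec_eq_zero_iff, ← h0, ← h1, ← h5]
    simp
  have q : ∀ l : Fin 3 → F, l ⬝ᵥ symMat y *ᵥ l = 0 ↔ ![x0, x1, x2] ⬝ᵥ l = 0 := by
    intro l
    rw [dotProduct_symMat_self, ← h0, ← h1, ← h5, ← sq_eq_zero_iff (a := _ ⬝ᵥ _)]
    simp [dotProduct, Fin.sum_univ_succ]
    grind
  simp only [q, hz]
  exact ncard_dotProduct_eq_zero _

variable {E : Type*} [Field E] [Algebra F E]

/-- Number of double lines in a squab, as vectors. -/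
theorem ncard_formType_zero [CharP F 2] (y : Vec6 F) [Decidable (diagVec y = 0)] :
    ({a : Vec6 F | a ∈ formType F E 0 ∧ a ⬝ᵥ y = 0}.ncard : ℚ) =
      (if diagVec y = 0 then (Nat.card F : ℚ) ^ 3 else (Nat.card F : ℚ) ^ 2) - 1 := by
  -- Double lines are exactly the nonzero diagonal forms, on which incidence with `y` sees only the
  -- diagonal of `symMat y`.
  have h1 : {a : Vec6 F | a ∈ formType F E 0 ∧ a ⬝ᵥ y = 0} =
      (fun d : Fin 3 → F => (![d 0, 0, 0, d 1, 0, d 2] : Vec6 F)) ''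
        ({d | diagVec y ⬝ᵥ d = 0} \ {0}) := by
    ext a
    constructor
    · rintro ⟨ha, hy⟩
      have hne := ne_zero_of_mem_formType ha
      rw [mem_formType_zero_iff hne] at ha
      have h4 : a 4 = 0 := congrFun ha 0
      have h2 : a 2 = 0 := congrFun ha 1
      have h1 : a 1 = 0 := congrFun ha 2
      have ea : (![a 0, 0, 0, a 3, 0, a 5] : Vec6 F) = a := by
        ext i; fin_cases i <;> simp [h1, h2, h4]
      refine ⟨![a 0, a 3, a 5], ⟨?_, ?_⟩, ea⟩
      · change _ = _
        rw [← hy]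
        simp [diagVec, dotProduct, Fin.sum_univ_succ, h1, h2, h4, mul_comm]
      · rintro (h0 : ![a 0, a 3, a 5] = 0)
        simp only [Matrix.cons_eq_zero_iff] at h0
        exact hne (by rw [← ea, h0.1, h0.2.1, h0.2.2.1]; ext i; fin_cases i <;> rfl)
    · rintro ⟨d, ⟨hd, hd0⟩, rfl⟩
      have hne : (![d 0, 0, 0, d 1, 0, d 2] : Vec6 F) ≠ 0 := by
        intro h
        refine hd0 (funext fun i => ?_)
        fin_cases i
        exacts [congrFun h 0, congrFun h 3, congrFun h 5]
      refine ⟨(mem_formType_zero_iff hne).2 (by ext i; fin_cases i <;> rfl), ?_⟩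
      change _ = (0 : F) at hd
      refine Eq.trans ?_ hd
      simp [diagVec, dotProduct, Fin.sum_univ_succ, mul_comm]
  rw [h1, Set.ncard_image_of_injective, Set.ncard_sdiff_singleton_of_mem (by simp),
    ncard_dotProduct_eq_zero, Nat.cast_sub]
  · split_ifs <;> simp
  · split_ifs <;> exact Nat.one_le_pow _ _ Nat.card_pos
  · intro d d' h
    ext i
    fin_cases i
    exacts [congrFun h 0, congrFun h 3, congrFun h 5]

/-- Factorizations differ by a unit and possibly a swap; the two families are disjoint because `l`
and `m` are independent. -/
theorem ncard_factorizations {l m : Fin 3 → F} (h : LinearIndependent F ![l, m]) :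
    {x : (Fin 3 → F) × (Fin 3 → F) | LinearIndependent F ![x.1, x.2] ∧
      prodVec x.1 x.2 = prodVec l m}.ncard = 2 * (Nat.card F - 1) := by
  have hset : {x : (Fin 3 → F) × (Fin 3 → F) | LinearIndependent F ![x.1, x.2] ∧
      prodVec x.1 x.2 = prodVec l m} =
      Set.range (fun u : Fˣ => ((u : F) • l, ((u⁻¹ : Fˣ) : F) • m)) ∪
      Set.range (fun u : Fˣ => ((u : F) • m, ((u⁻¹ : Fˣ) : F) • l)) := by
    ext ⟨l', m'⟩
    rw [Set.mem_ofPred_eq, prodVec_eq_prodVec_iff h]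
    constructor
    · rintro ⟨-, u, ⟨rfl, rfl⟩ | ⟨rfl, rfl⟩⟩
      exacts [Or.inl ⟨u, rfl⟩, Or.inr ⟨u, rfl⟩]
    · have h' : LinearIndependent F ![m, l] := LinearIndependent.pair_symm_iff.1 h
      rintro (⟨u, hu⟩ | ⟨u, hu⟩) <;> obtain ⟨rfl, rfl⟩ := Prod.mk.inj hu
      · exact ⟨linearIndependent_pair_smul h _ _, u, Or.inl ⟨rfl, rfl⟩⟩
      · exact ⟨linearIndependent_pair_smul h' _ _, u, Or.inr ⟨rfl, rfl⟩⟩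
  have hl : l ≠ 0 := h.ne_zero 0
  have hm : m ≠ 0 := h.ne_zero 1
  rw [hset, Set.ncard_union_eq, Set.ncard_range_of_injective, Set.ncard_range_of_injective,
    Nat.card_units, two_mul]
  · intro u v huv
    exact Units.ext (smul_left_injective F hm (Prod.mk.inj huv).1)
  · intro u v huv
    exact Units.ext (smul_left_injective F hl (Prod.mk.inj huv).1)
  · rw [Set.disjoint_left]
    rintro _ ⟨u, rfl⟩ ⟨v, hv⟩
    have h1 := (Prod.mk.inj hv).1
    rw [LinearIndependent.pair_iff] at h
    have := h (u : F) (-(v : F)) (by rw [neg_smul, h1, add_neg_cancel])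
    exact u.ne_zero this.1

/-- Ordered pairs of independent linear forms over the products in a squab. -/
theorem ncard_pairs_eq_mul (y : Vec6 F) :
    {x : (Fin 3 → F) × (Fin 3 → F) | LinearIndependent F ![x.1, x.2] ∧
      x.1 ⬝ᵥ symMat y *ᵥ x.2 = 0}.ncard =
    {a : Vec6 F | a ∈ formType F E 1 ∧ a ⬝ᵥ y = 0}.ncard * (2 * (Nat.card F - 1)) := by
  classical
  have := Fintype.ofFinite F
  let S : Finset ((Fin 3 → F) × (Fin 3 → F)) := {x | LinearIndependent F ![x.1, x.2] ∧
      x.1 ⬝ᵥ symMat y *ᵥ x.2 = 0}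
  let T : Finset (Vec6 F) := {a | a ∈ formType F E 1 ∧ a ⬝ᵥ y = 0}
  have hmap : ∀ x ∈ S, prodVec x.1 x.2 ∈ T := by
    intro x hx
    simp only [S, T, Finset.mem_filter, Finset.mem_univ, true_and] at hx ⊢
    exact ⟨⟨_, _, hx.1, rfl⟩, by rw [prodVec_dotProduct]; exact hx.2⟩
  have hc := Finset.card_eq_sum_card_fiberwise hmap
  have hfib : ∀ a ∈ T, (S.filter fun x => prodVec x.1 x.2 = a).card = 2 * (Nat.card F - 1) := by
    intro a ha
    simp only [T, Finset.mem_filter, Finset.mem_univ, true_and] at ha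
    obtain ⟨⟨l, m, hlm, rfl⟩, hy⟩ := ha
    rw [← ncard_factorizations hlm, ← Set.ncard_coe_finset]
    congr 1
    ext x
    simp only [S, Finset.coe_filter, Finset.mem_filter, Finset.mem_univ, true_and,
      Set.mem_ofPred_eq]
    refine ⟨fun hx => ⟨hx.1.1, hx.2⟩, fun hx => ⟨⟨hx.1, ?_⟩, hx.2⟩⟩
    rw [← prodVec_dotProduct, hx.2, hy]
  rw [Finset.sum_congr rfl hfib, Finset.sum_const, smul_eq_mul] at hc
  rw [← Set.ncard_coe_finset, ← Set.ncard_coe_finset] at hc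
  simpa [S, T] using hc

/-- The vectors orthogonal to `l M` form a plane, or the whole space if `l M = 0`. From them one
removes the multiples of `l`: all `q` if `l` is isotropic, only zero otherwise. -/
theorem ncard_pairs_left {l : Fin 3 → F} (hl : l ≠ 0) (y : Vec6 F)
    [Decidable (l ⬝ᵥ symMat y *ᵥ l = 0)] [Decidable (l ᵥ* symMat y = 0)] :
    ({m : Fin 3 → F | LinearIndependent F ![l, m] ∧ l ⬝ᵥ symMat y *ᵥ m = 0}.ncard : ℚ) =
      (if l ᵥ* symMat y = 0 then (Nat.card F : ℚ) ^ 3 else (Nat.card F : ℚ) ^ 2) -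
        (if l ⬝ᵥ symMat y *ᵥ l = 0 then (Nat.card F : ℚ) else 1) := by
  have e : {m : Fin 3 → F | LinearIndependent F ![l, m] ∧ l ⬝ᵥ symMat y *ᵥ m = 0} =
      {m | (l ᵥ* symMat y) ⬝ᵥ m = 0} \ {m : Fin 3 → F | ∃ c : F, m = c • l} := by
    ext m
    rw [Set.mem_ofPred_eq, LinearIndependent.pair_iff' hl, Matrix.dotProduct_mulVec]
    constructor
    · rintro ⟨h1, h2⟩
      exact ⟨h2, fun ⟨c, hc⟩ => h1 c hc.symm⟩
    · rintro ⟨h1, h2⟩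
      exact ⟨fun c hc => h2 ⟨c, hc.symm⟩, h1⟩
  have h1 := Set.ncard_inter_add_ncard_sdiff_eq_ncard {m | (l ᵥ* symMat y) ⬝ᵥ m = 0}
    {m : Fin 3 → F | ∃ c : F, m = c • l} (Set.toFinite _)
  rw [Set.inter_comm, ncard_span_singleton_inter hl, ncard_dotProduct_eq_zero] at h1
  rw [e, eq_sub_iff_add_eq, add_comm]
  exact_mod_cast h1

theorem ncard_pairs [CharP F 2] (y : Vec6 F) [Decidable (diagVec y = 0)] :
    ({x : (Fin 3 → F) × (Fin 3 → F) | LinearIndependent F ![x.1, x.2] ∧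
      x.1 ⬝ᵥ symMat y *ᵥ x.2 = 0}.ncard : ℚ) =
    (Nat.card F : ℚ) ^ (3 - (symMat y).rank) * (Nat.card F : ℚ) ^ 3 +
      ((Nat.card F : ℚ) ^ 3 - (Nat.card F : ℚ) ^ (3 - (symMat y).rank)) * (Nat.card F : ℚ) ^ 2 -
      ((if diagVec y = 0 then (Nat.card F : ℚ) ^ 3 else (Nat.card F : ℚ) ^ 2) * Nat.card F +
        ((Nat.card F : ℚ) ^ 3 -
          (if diagVec y = 0 then (Nat.card F : ℚ) ^ 3 else (Nat.card F : ℚ) ^ 2)) * 1) -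
      ((Nat.card F : ℚ) ^ 3 - Nat.card F) := by
  classical
  have := Fintype.ofFinite F
  rw [ncard_setOf_prod, Nat.cast_sum]
  -- The last term corrects `l = 0`, where the first two would give `q³ - q` although no independent
  -- pair starts with zero.
  have key : ∀ l : Fin 3 → F,
      ({m : Fin 3 → F | LinearIndependent F ![l, m] ∧ l ⬝ᵥ symMat y *ᵥ m = 0}.ncard : ℚ) =
      (if l ᵥ* symMat y = 0 then (Nat.card F : ℚ) ^ 3 else (Nat.card F : ℚ) ^ 2) -
        (if l ⬝ᵥ symMat y *ᵥ l = 0 then (Nat.card F : ℚ) else 1) -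
        (if l = 0 then (Nat.card F : ℚ) ^ 3 - Nat.card F else 0) := by
    intro l
    by_cases hl : l = 0
    · subst hl
      have : {m : Fin 3 → F | LinearIndependent F ![0, m] ∧ 0 ⬝ᵥ symMat y *ᵥ m = 0} = ∅ := by
        ext m
        simp only [Set.mem_ofPred_eq, Set.mem_empty_iff_false, iff_false]
        exact fun h => h.1.ne_zero 0 rfl
      rw [this]
      simp
    · rw [ncard_pairs_left hl, if_neg hl, sub_zero]
  rw [Finset.sum_congr rfl fun l _ => key l, Finset.sum_sub_distrib, Finset.sum_sub_distrib,
    sum_ite_eq_ncard, sum_ite_eq_ncard, ncard_vecMul_eq_zero, ncard_dotProduct_self_eq_zero]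
  simp

theorem ncard_affine_ne_zero (c : F) {x y : F} (h : ¬ (x = 0 ∧ y = 0)) :
    ({p : F × F | c + p.1 * x + p.2 * y ≠ 0}.ncard : ℚ) = (Nat.card F : ℚ) ^ 2 - Nat.card F := by
  have hz : {p : F × F | c + p.1 * x + p.2 * y = 0}.ncard = Nat.card F := by
    by_cases hx : x = 0
    · have hy : y ≠ 0 := fun hy => h ⟨hx, hy⟩
      have e : {p : F × F | c + p.1 * x + p.2 * y = 0} =
          Set.range fun u : F => (u, -(c + u * x) / y) := by
        ext ⟨u, v⟩
        simp only [Set.mem_ofPred_eq, Set.mem_range, Prod.mk.injEq, exists_eq_left]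
        rw [div_eq_iff hy]
        constructor <;> intro h <;> linear_combination -h
      rw [e, Set.ncard_range_of_injective fun u v huv => (Prod.mk.inj huv).1]
    · have e : {p : F × F | c + p.1 * x + p.2 * y = 0} =
          Set.range fun v : F => (-(c + v * y) / x, v) := by
        ext ⟨u, v⟩
        simp only [Set.mem_ofPred_eq, Set.mem_range, Prod.mk.injEq, exists_eq_right]
        rw [div_eq_iff hx]
        constructor <;> intro h <;> linear_combination -h
      rw [e, Set.ncard_range_of_injective fun u v huv => (Prod.mk.inj huv).2]
  have h1 := Set.ncard_add_ncard_compl {p : F × F | c + p.1 * x + p.2 * y = 0}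
  rw [hz, Nat.card_prod] at h1
  have h2 : {p : F × F | c + p.1 * x + p.2 * y ≠ 0} =
      {p : F × F | c + p.1 * x + p.2 * y = 0}ᶜ := rfl
  rw [h2, eq_sub_iff_add_eq, add_comm]
  have h3 : (Nat.card F : ℚ) ^ 2 = ((Nat.card F * Nat.card F : ℕ) : ℚ) := by push_cast; ring
  rw [h3, ← h1]
  push_cast
  rfl

/-- For `(x, y) ≠ (0, 0)` the expression is a nonconstant affine function of the last two parameters
and is nonzero `q² - q` times, whatever `g` is. At `(0, 0)` only `g 0 0 t` remains. -/
theorem ncard_pencil_ne_zero (g : F → F → F → F) :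
    ({p : F × (F × F) × (F × F) |
      g p.2.1.1 p.2.1.2 p.1 + p.2.2.1 * p.2.1.1 ^ 2 + p.2.2.2 * p.2.1.2 ^ 2 ≠ 0}.ncard : ℚ) =
    Nat.card F * (((Nat.card F : ℚ) ^ 2 - 1) * ((Nat.card F : ℚ) ^ 2 - Nat.card F)) +
      ({t | g 0 0 t ≠ 0}.ncard : ℚ) * (Nat.card F : ℚ) ^ 2 := by
  classical
  have := Fintype.ofFinite F
  rw [ncard_setOf_prod, Nat.cast_sum]
  have hin : ∀ t : F, ({b : (F × F) × (F × F) |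
      g b.1.1 b.1.2 t + b.2.1 * b.1.1 ^ 2 + b.2.2 * b.1.2 ^ 2 ≠ 0}.ncard : ℚ) =
      ((Nat.card F : ℚ) ^ 2 - 1) * ((Nat.card F : ℚ) ^ 2 - Nat.card F) +
        if g 0 0 t ≠ 0 then (Nat.card F : ℚ) ^ 2 else 0 := by
    intro t
    rw [ncard_setOf_prod, Nat.cast_sum, ← Finset.sum_erase_add _ _ (Finset.mem_univ (0 : F × F))]
    congr 1
    · have h : ∀ b ∈ Finset.univ.erase (0 : F × F), ({x : F × F |
          g b.1 b.2 t + x.1 * b.1 ^ 2 + x.2 * b.2 ^ 2 ≠ 0}.ncard : ℚ) =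
          (Nat.card F : ℚ) ^ 2 - Nat.card F := by
        intro b hb
        refine ncard_affine_ne_zero _ fun h => (Finset.mem_erase.1 hb).1 ?_
        rw [sq_eq_zero_iff, sq_eq_zero_iff] at h
        exact Prod.ext h.1 h.2
      rw [Finset.sum_congr rfl h, Finset.sum_const, Finset.card_erase_of_mem (Finset.mem_univ _),
        nsmul_eq_mul, Finset.card_univ, Fintype.card_prod, ← Nat.card_eq_fintype_card,
        Nat.cast_sub (Nat.mul_pos Nat.card_pos Nat.card_pos)]
      push_cast
      ring
    · split_ifs with h
      · simp [h, Set.ncard_univ, pow_two]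
      · simp only [ne_eq, not_not] at h
        simp [h]
  rw [Finset.sum_congr rfl fun t _ => hin t, Finset.sum_add_distrib, Finset.sum_const,
    sum_ite_eq_ncard, Finset.card_univ, ← Nat.card_eq_fintype_card]
  simp

end Counting

/-! ### Non-singular forms at the representatives and assembly of the distributions -/

section Distribution

variable {F : Type*} [Field F]

theorem disc_eq_of_charTwo [CharP F 2] (a : Vec6 F) :
    disc a = a 1 * a 2 * a 4 + a 0 * a 4 ^ 2 + a 3 * a 2 ^ 2 + a 5 * a 1 ^ 2 := by
  have h2 : (2 : F) = 0 := CharTwo.two_eq_zero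
  rw [disc]
  linear_combination (2 * a 0 * a 3 * a 5 - a 0 * a 4 ^ 2 - a 3 * a 2 ^ 2 - a 5 * a 1 ^ 2) * h2

/-- Needed for ranks one and three, where being off the nucleus plane is not part of the definition;
it is read off the normal form. -/
theorem diagVec_ne_zero [Finite F] [CharP F 2] {i : Fin 4} {P : ℙ F (Vec6 F)}
    (hP : P ∈ pointType F i) (hi : i ≠ 1) : diagVec P.rep ≠ 0 := by
  obtain ⟨A, hA⟩ := exists_congrLin_pointRep_eq P.rep_nonzero ((mem_pointType_iff i P).1 hP)
  rw [Ne, diagVec_eq_zero_iff, ← hA, congrLin_diag_iff]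
  fin_cases i <;> simp [pointRep] at hi ⊢

theorem ncard_disc_ne_zero_of_param [Finite F] {y : Vec6 F}
    (φ : F × (F × F) × (F × F) → Vec6 F) (hinj : Function.Injective φ)
    (hrange : ∀ a, a ⬝ᵥ y = 0 ↔ a ∈ Set.range φ) (g : F → F → F → F)
    (hdisc : ∀ p, disc (φ p) =
      g p.2.1.1 p.2.1.2 p.1 + p.2.2.1 * p.2.1.1 ^ 2 + p.2.2.2 * p.2.1.2 ^ 2) :
    ({a : Vec6 F | disc a ≠ 0 ∧ a ⬝ᵥ y = 0}.ncard : ℚ) =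
    Nat.card F * (((Nat.card F : ℚ) ^ 2 - 1) * ((Nat.card F : ℚ) ^ 2 - Nat.card F)) +
      ({t | g 0 0 t ≠ 0}.ncard : ℚ) * (Nat.card F : ℚ) ^ 2 := by
  rw [← ncard_pencil_ne_zero, ← Set.ncard_image_of_injective _ hinj]
  congr 2
  ext a
  constructor
  · rintro ⟨h1, h2⟩
    obtain ⟨p, rfl⟩ := (hrange a).1 h2
    exact ⟨p, fun h => h1 ((hdisc p).trans h), rfl⟩
  · rintro ⟨p, hp, rfl⟩
    exact ⟨fun h => hp ((hdisc p).symm.trans h), (hrange _).2 ⟨p, rfl⟩⟩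

/-- Parametrizations of the forms orthogonal to the four representatives of points. -/
def squabParam (F : Type*) [Field F] : Fin 4 → F × (F × F) × (F × F) → Vec6 F :=
  ![fun p => ![0, p.2.1.1, p.2.1.2, p.2.2.2, p.1, p.2.2.1],
    fun p => ![p.2.2.2, 0, p.2.1.1, p.2.2.1, p.2.1.2, p.1],
    fun p => ![p.2.1.1, p.2.1.1, p.2.1.2, p.2.2.2, p.1, p.2.2.1],
    fun p => ![p.1, p.2.1.1, p.2.1.2, p.2.2.2, p.1, p.2.2.1]]

theorem squabParam_injective (i : Fin 4) : Function.Injective (squabParam F i) := by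
  rintro ⟨t, ⟨x, y⟩, u, v⟩ ⟨t', ⟨x', y'⟩, u', v'⟩ h
  have h0 := congrFun h 0
  have h1 := congrFun h 1
  have h2 := congrFun h 2
  have h3 := congrFun h 3
  have h4 := congrFun h 4
  have h5 := congrFun h 5
  fin_cases i <;> simp_all [squabParam]

theorem dotProduct_pointRep_eq_zero_iff [CharP F 2] (i : Fin 4) (a : Vec6 F) :
    a ⬝ᵥ pointRep F i = 0 ↔ a ∈ Set.range (squabParam F i) := by
  constructor
  · intro h
    fin_cases i <;> simp [pointRep, dotProduct, Fin.sum_univ_succ, CharTwo.add_eq_zero] at h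
    · exact ⟨(a 4, (a 1, a 2), (a 5, a 3)), by
        ext i; fin_cases i <;> simp [squabParam, h]⟩
    · exact ⟨(a 5, (a 2, a 4), (a 3, a 0)), by
        ext i; fin_cases i <;> simp [squabParam, h]⟩
    · exact ⟨(a 4, (a 1, a 2), (a 5, a 3)), by
        ext i; fin_cases i <;> simp [squabParam, h]⟩
    · exact ⟨(a 4, (a 1, a 2), (a 5, a 3)), by
        ext i; fin_cases i <;> simp [squabParam, h]⟩
  · rintro ⟨p, rfl⟩
    fin_cases i <;>
      simp [squabParam, pointRep, dotProduct, Fin.sum_univ_succ, CharTwo.add_self_eq_zero]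

theorem ncard_disc_ne_zero_pointRep [Finite F] [CharP F 2] (i : Fin 4) :
    ({a : Vec6 F | disc a ≠ 0 ∧ a ⬝ᵥ pointRep F i = 0}.ncard : ℚ) =
    Nat.card F * (((Nat.card F : ℚ) ^ 2 - 1) * ((Nat.card F : ℚ) ^ 2 - Nat.card F)) +
      (if i = 3 then (Nat.card F : ℚ) - 1 else 0) * (Nat.card F : ℚ) ^ 2 := by
  -- The part of the discriminant free of the last two parameters. At `x = y = 0` it survives only
  -- for rank three, as `t³`; this is the source of the extra `(q - 1) q²` vectors.
  let g : Fin 4 → F → F → F → F := ![fun x y t => x * y * t, fun _ _ _ => 0,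
    fun x y t => x * y * t + x * t ^ 2, fun x y t => x * y * t + t ^ 3]
  rw [ncard_disc_ne_zero_of_param (squabParam F i) (squabParam_injective i)
    (dotProduct_pointRep_eq_zero_iff i) (g i)]
  · congr 2
    fin_cases i
    · simp [g]
    · simp [g]
    · simp [g]
    · have : {t : F | g 3 0 0 t ≠ 0} = {0}ᶜ := by
        ext t; simp [g]
      change (({t : F | g 3 0 0 t ≠ 0}.ncard : ℕ) : ℚ) = _
      rw [this, Set.ncard_compl, Set.ncard_singleton, Nat.cast_sub Nat.card_pos]
      simp
  · intro p
    rw [disc_eq_of_charTwo]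
    fin_cases i <;> simp [squabParam, g] <;> ring

variable {E : Type*} [Field E] [Algebra F E]

/-- `coact A` is a bijection respecting types and exchanging the two incidence conditions, so counts
depend only on the orbit of the point. -/
theorem ncard_formType_congrLin [Finite F] [CharP F 2] (hE : Module.finrank F E = 2)
    (A : GL (Fin 3) F) (i : Fin 4) (y : Vec6 F) :
    {a | a ∈ formType F E i ∧ a ⬝ᵥ congrLin (A : Matrix (Fin 3) (Fin 3) F) y = 0}.ncard =
      {a | a ∈ formType F E i ∧ a ⬝ᵥ y = 0}.ncard := by
  have hinj : Function.Injective (coact (A : Matrix (Fin 3) (Fin 3) F)) :=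
    Function.LeftInverse.injective (coact_inv_coact A)
  rw [← Set.ncard_image_of_injective _ hinj]
  congr 1
  ext a
  constructor
  · rintro ⟨b, ⟨hb, hy⟩, rfl⟩
    exact ⟨coact_mem_formType hE A hb, by rw [coact_dotProduct]; exact hy⟩
  · rintro ⟨ha, hy⟩
    exact ⟨_, ⟨coact_mem_formType hE A⁻¹ ha, by
      rw [← coact_dotProduct, coact_coact_inv]; exact hy⟩, coact_coact_inv A a⟩

/-- The types partition the nonzero vectors of the five-dimensional space `perp y`. This replaces a
direct count of conjugate pairs. -/
theorem sum_ncard_formType [Finite F] [CharP F 2] (hE : Module.finrank F E = 2) {y : Vec6 F}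
    (hy : y ≠ 0) : ∑ i, ({a | a ∈ formType F E i ∧ a ⬝ᵥ y = 0}.ncard : ℚ) =
      (Nat.card F : ℚ) ^ 5 - 1 := by
  have h1 := ncard_setOf_prod
    (fun x : Fin 4 × Vec6 F => x.2 ∈ formType F E x.1 ∧ x.2 ⬝ᵥ y = 0)
  rw [← Nat.cast_sum, ← h1]
  have hinj : Set.InjOn (Prod.snd : Fin 4 × Vec6 F → Vec6 F)
      {x | x.2 ∈ formType F E x.1 ∧ x.2 ⬝ᵥ y = 0} := by
    rintro ⟨i, a⟩ ⟨hi, -⟩ ⟨j, b⟩ ⟨hj, -⟩ (rfl : a = b)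
    exact Prod.ext (formType_disjoint hi hj) rfl
  have himg : (Prod.snd : Fin 4 × Vec6 F → Vec6 F) ''
      {x | x.2 ∈ formType F E x.1 ∧ x.2 ⬝ᵥ y = 0} = (perp y : Set (Vec6 F)) \ {0} := by
    ext a
    constructor
    · rintro ⟨⟨i, b⟩, ⟨hi, hb⟩, rfl⟩
      exact ⟨mem_perp.2 ((dotProduct_comm _ _).trans hb), ne_zero_of_mem_formType hi⟩
    · rintro ⟨ha, hne⟩
      obtain ⟨i, hi⟩ := exists_mem_formType hE hne
      exact ⟨(i, a), ⟨hi, (dotProduct_comm _ _).trans (mem_perp.1 ha)⟩, rfl⟩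
  have hcard : (perp y : Set (Vec6 F)).ncard = Nat.card F ^ 5 := by
    rw [← Nat.card_coe_set_eq]
    change Nat.card (perp y) = _
    rw [Module.natCard_eq_pow_finrank (K := F), finrank_perp hy]
  rw [← hinj.ncard_image, himg,
    Set.ncard_sdiff_singleton_of_mem (zero_mem (perp y)), hcard,
    Nat.cast_sub (Nat.one_le_pow _ _ Nat.card_pos)]
  simp

theorem OD4_mul [Finite F] (P : ℙ F (Vec6 F)) (i : Fin 4) :
    (OD4 F E P.submodule i : ℚ) * ((Nat.card F : ℚ) - 1) =
      ({a | a ∈ formType F E i ∧ a ⬝ᵥ P.rep = 0}.ncard : ℚ) := by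
  have h := ncard_rep_mul (T := {a : Vec6 F | a ∈ formType F E i ∧ a ⬝ᵥ P.rep = 0})
    (fun h => ne_zero_of_mem_formType h.1 rfl) (fun k a hk => by
      change _ ∧ _ ↔ _ ∧ _
      rw [smul_mem_formType_iff hk, smul_dotProduct, smul_eq_mul, mul_eq_zero, or_iff_right hk])
  rw [OD4_submodule, ← h, Nat.cast_mul, Nat.cast_sub Nat.card_pos, Nat.cast_one]
  rfl

/-- The distribution of a point, in terms of the number `k` of vectors in the kernel of its matrix
and the number `z` of isotropic vectors. -/
theorem OD4_eq [Finite F] [CharP F 2] (hE : Module.finrank F E = 2) {i : Fin 4}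
    {P : ℙ F (Vec6 F)} (hP : P ∈ pointType F i) {q k z : ℚ} (hq : (Nat.card F : ℚ) = q)
    (hk : q ^ (3 - (symMat P.rep).rank) = k)
    (hz : diagVec P.rep = 0 ∧ z = q ^ 3 ∨ diagVec P.rep ≠ 0 ∧ z = q ^ 2) {h₀ h₁ h₂ h₃ : ℚ}
    (e₀ : h₀ * (q - 1) = z - 1)
    (e₁ : h₁ * (q - 1) * (2 * (q - 1)) =
      k * q ^ 3 + (q ^ 3 - k) * q ^ 2 - (z * q + (q ^ 3 - z)) - (q ^ 3 - q))
    (e₃ : h₃ * (q - 1) = q * ((q ^ 2 - 1) * (q ^ 2 - q)) + (if i = 3 then q - 1 else 0) * q ^ 2)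
    (e : (h₀ + h₁ + h₂ + h₃) * (q - 1) = q ^ 5 - 1) :
    (fun j => (OD4 F E P.submodule j : ℚ)) = ![h₀, h₁, h₂, h₃] := by
  classical
  have hq1 : q - 1 ≠ 0 := by
    rw [← hq, sub_ne_zero]
    exact_mod_cast Finite.one_lt_card.ne'
  have hP' := (mem_pointType_iff i P).1 hP
  have c0 := OD4_mul (E := E) P 0
  have c1 := OD4_mul (E := E) P 1
  have c2 := OD4_mul (E := E) P 2
  have c3 := OD4_mul (E := E) P 3
  have hsum := sum_ncard_formType hE P.rep_nonzero
  simp only [Fin.sum_univ_four, ← c0, ← c1, ← c2, ← c3, hq] at hsum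
  rw [ncard_formType_zero, hq] at c0
  have hpairs := ncard_pairs P.rep
  have hz' : (if diagVec P.rep = 0 then q ^ 3 else q ^ 2) = z := by
    rcases hz with ⟨h, rfl⟩ | ⟨h, rfl⟩ <;> simp [h]
  rw [ncard_pairs_eq_mul (E := E), hq, hk, hz', Nat.cast_mul, ← c1, Nat.cast_mul,
    Nat.cast_sub Nat.card_pos, hq] at hpairs
  rw [hz'] at c0
  obtain ⟨A, hA⟩ := exists_congrLin_pointRep_eq P.rep_nonzero hP'
  rw [← hA, ncard_formType_congrLin hE] at c3
  have c3' := ncard_disc_ne_zero_pointRep (F := F) i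
  change (({a | a ∈ formType F E 3 ∧ a ⬝ᵥ pointRep F i = 0}.ncard : ℕ) : ℚ) = _ at c3'
  rw [c3', hq] at c3
  have r0 : (OD4 F E P.submodule 0 : ℚ) = h₀ := mul_right_cancel₀ hq1 (c0.trans e₀.symm)
  have r3 : (OD4 F E P.submodule 3 : ℚ) = h₃ := mul_right_cancel₀ hq1 (c3.trans e₃.symm)
  have r1 : (OD4 F E P.submodule 1 : ℚ) = h₁ := by
    -- One factor `q - 1` passes from conics to vectors, the factor `2 (q - 1)` from products to
    -- ordered factorizations.
    refine mul_right_cancel₀ hq1 (mul_right_cancel₀ (mul_ne_zero two_ne_zero hq1) ?_)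
    rw [e₁, ← mul_one (z * q + (q ^ 3 - z))]
    push_cast at hpairs
    linarith
  have r2 : (OD4 F E P.submodule 2 : ℚ) = h₂ := by
    rw [r0, r1, r3] at hsum
    refine mul_right_cancel₀ hq1 ?_
    linarith
  funext j
  fin_cases j
  exacts [r0, r1, r2, r3]

end Distribution

end

/-! ### The theorem -/

theorem mainTheorem2 (F E : Type*) [Field F] [Finite F] [Field E] [Algebra F E]
    (hE : Module.finrank F E = 2) (q : ℕ) (hcard : Nat.card F = q) (hq : Even q) :
    -- the four `K`-orbits of points and the four `K`-orbits of hyperplanes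
    (pointOrbits F = {P1 F, P2n F, P2s F, P3 F} ∧ (pointOrbits F).ncard = 4) ∧
    (hyperplaneOrbits F = Set.range (hyperplaneType F E) ∧ (hyperplaneOrbits F).ncard = 4) ∧
    -- the hyperplane-orbit distributions of the points
    (∀ P ∈ P1 F, (fun i => (OD4 F E P.submodule i : ℚ)) =
      ![(q : ℚ) + 1, (q : ℚ) ^ 3 + (3 * (q : ℚ) ^ 2 + q) / 2, ((q : ℚ) ^ 2 - q) / 2,
        (q : ℚ) ^ 4 - (q : ℚ) ^ 2]) ∧
    (∀ P ∈ P2n F, (fun i => (OD4 F E P.submodule i : ℚ)) =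
      ![(q : ℚ) ^ 2 + q + 1, ((q : ℚ) ^ 3 + 2 * (q : ℚ) ^ 2 + q) / 2, ((q : ℚ) ^ 3 - q) / 2,
        (q : ℚ) ^ 4 - (q : ℚ) ^ 2]) ∧
    (∀ P ∈ P2s F, (fun i => (OD4 F E P.submodule i : ℚ)) =
      ![(q : ℚ) + 1, ((q : ℚ) ^ 3 + 3 * (q : ℚ) ^ 2 + q) / 2,
        ((q : ℚ) ^ 3 + (q : ℚ) ^ 2 - q) / 2, (q : ℚ) ^ 4 - (q : ℚ) ^ 2]) ∧
    (∀ P ∈ P3 F, (fun i => (OD4 F E P.submodule i : ℚ)) =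
      ![(q : ℚ) + 1, ((q : ℚ) ^ 3 + 2 * (q : ℚ) ^ 2 + q) / 2, ((q : ℚ) ^ 3 - q) / 2,
        (q : ℚ) ^ 4]) ∧
    -- the same numbers count the conics of each type in the corresponding squabs of conics
    Set.BijOn (squabOf : ℙ F (Vec6 F) → Submodule F (Vec6 F)) Set.univ
      {S | Module.finrank F S = 5} ∧
    (∀ P : ℙ F (Vec6 F), conicDist F E (squabOf P) = OD4 F E P.submodule) := by
  have hchar : ringChar F = 2 := by
    have := Fintype.ofFinite F
    rw [FiniteField.even_card_iff_char_two, ← Nat.card_eq_fintype_card, hcard]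
    exact Nat.even_iff.1 hq
  have : CharP F 2 := hchar ▸ ringChar.charP F
  have hcard' : (Nat.card F : ℚ) = q := by rw [hcard]
  refine ⟨⟨pointOrbits_eq, ncard_pointOrbits⟩, ⟨hyperplaneOrbits_eq hE, ncard_hyperplaneOrbits hE⟩,
    fun P hP => ?_, fun P hP => ?_, fun P hP => ?_, fun P hP => ?_, squabOf_bijOn,
    fun P => funext fun i => (conicDist_squabOf P i).trans (OD4_submodule P i).symm⟩
  · have hr : (symMat P.rep).rank = 1 := hP
    have hd : diagVec P.rep ≠ 0 := diagVec_ne_zero (i := 0) hP (by decide)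
    -- Rank and diagonal fix `k` and `z`, and the type `i` fixes the non-singular count; what
    -- remains are polynomial identities in `q`, the last being the total count.
    refine OD4_eq hE (i := 0) hP hcard' rfl (Or.inr ⟨hd, rfl⟩) ?_ ?_ ?_ ?_
    · ring
    · rw [hr]; ring
    · rw [if_neg (by decide)]; ring
    · ring
  · have hr : (symMat P.rep).rank = 2 := hP.1
    refine OD4_eq hE (i := 1) hP hcard' rfl
      (Or.inl ⟨(diagVec_eq_zero_iff _).2 hP.2, rfl⟩) ?_ ?_ ?_ ?_
    · ring
    · rw [hr]; ring
    · rw [if_neg (by decide)]; ring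
    · ring
  · have hr : (symMat P.rep).rank = 2 := hP.1
    refine OD4_eq hE (i := 2) hP hcard' rfl
      (Or.inr ⟨fun h => hP.2 ((diagVec_eq_zero_iff _).1 h), rfl⟩) ?_ ?_ ?_ ?_
    · ring
    · rw [hr]; ring
    · rw [if_neg (by decide)]; ring
    · ring
  · have hr : (symMat P.rep).rank = 3 := hP
    have hd : diagVec P.rep ≠ 0 := diagVec_ne_zero (i := 3) hP (by decide)
    refine OD4_eq hE (i := 3) hP hcard' rfl (Or.inr ⟨hd, rfl⟩) ?_ ?_ ?_ ?_
    · ring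
    · rw [hr]; ring
    · rw [if_pos rfl]; ring
    · ring
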